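/- For $n\ge 1$ let $\mathfrak h$ be the complex vector space with basis $\beta^1,\dots,\beta^n,\alpha^1,\dots,\alpha^n$ and the symmetric bilinear form for which this basis is orthonormal, and let $M(1)$ be the associated Heisenberg vertex operator algebra of level $1$. That is, $M(1)$ is the symmetric algebra $\mathbb C[h(-m)\mid h \text{ in the basis},\ m\ge 1]$ with vacuum $\mathbf 1=1$; for a basis vector $h$, the operator $h(-m)$ ($m\ge1$) acts by multiplication, $h(m)=m\,\partial/\partial h(-m)$ for $m\ge 1$, $h(0)=0$, and $h(z)=\sum_{m\in\mathbb Z}h(m)z^{-m-1}$; for basis vectors $h_1,\dots,h_k$ and integers $m_1,\dots,m_k\ge1$, the vertex operator of $v=h_1(-m_1)\cdots h_k(-m_k)\mathbf 1$ is the normally ordered product $$Y(v,z)=\sum_{p\in\mathbb Z}v_pz^{-p-1}={}^{\circ}_{\circ}\prod_{j=1}^k\frac{1}{(m_j-1)!}\Big(\frac{d}{dz}\Big)^{m_j-1}h_j(z)\,{}^{\circ}_{\circ},$$ extended linearly to all $v\in M(1)$, where normal ordering places the operators $h(m)$ with $m<0$ to the left of those with $m\ge 0$. Let $C_2(M(1))=\operatorname{span}_{\mathbb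 C}\{u_{-2}v\mid u,v\in M(1)\}$ and, identifying $h\in\mathfrak h$ with $h(-1)\mathbf 1$, let $f_i=\beta^i_{1}-\alpha^i_{-1}:M(1)\to M(1)$ for $1\le i\le n$. For a subspace $M$ of a vertex algebra $V$, let $r_{0,-1}(M)$ be the set of $v\in V$ for which there is $m\ge 0$ such that $v_{n_1}\cdots v_{n_t}v\in M$ for all $t\ge m$ and $n_1,\dots,n_t\in\{0,-1\}$. Let $sr_{0,-1}(M)$ be the set of $v\in V$ such that for every $b\in V$ there is $m\ge0$ such that both $b_s(v_{n_1}\cdots v_{n_t}v)\in M$ and $(v_{n_1}\cdots v_{n_t}v)_s b\in M$ for all $t\ge m$ and $s,n_1,\dots,n_t\in\{0,-1\}$. Call $M$ an $MZ_{0,-1}$-subspace of $V$ if $r_{0,-1}(M)=sr_{0,-1}(M)$. Suppose that for every $n\ge 1$ the subspace $\sum_{i=1}^n f_i(M(1))+C_2(M(1))$ is an $MZ_{0,-1}$-subspace of $M(1)$. Then the Jacobian conjecture holds in every dimension: for every positive integer $n$, every $\mathbb C$-algebra endomorphism $\phi$ of $\mathbb C[x_1,\dots,x_n]$ with $\det\left(\frac{\partial\phi(x_i)}{\partial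 x_j}\right)_{1\le i,j\le n}=1$ is an automorphism. -/

import Mathlib

noncomputable section

/-! ### Mathieu-Zhao subspaces with respect to the `0`-th and `(-1)`-st products -/

namespace MZVertex

variable {V : Type*} [AddCommGroup V] [Module ℂ V]

/-- The `n`-th product: `nthMode Y v n` is the endomorphism `v_n` in
`Y(v, z) = ∑ v_n z^(-n-1)`. -/
def nthMode (Y : V →ₗ[ℂ] VertexOperator ℂ V) (v : V) (n : ℤ) : Module.End ℂ V :=
  VertexOperator.ncoeff (Y v) n

/-- `C₂(V)`, the linear span of all `u_{-2} v`. -/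
def cTwo (Y : V →ₗ[ℂ] VertexOperator ℂ V) : Submodule ℂ V :=
  Submodule.span ℂ {x | ∃ u v : V, x = nthMode Y u (-2) v}

/-- For `L = [n₁, …, n_t]` the vector `v_{n₁} v_{n₂} ⋯ v_{n_t} v`. -/
def iterProd (Y : V →ₗ[ℂ] VertexOperator ℂ V) (v : V) (L : List ℤ) : V :=
  L.foldr (fun n a => nthMode Y v n a) v

/-- All entries of the list are `0` or `-1`. -/
def IsZeroNegOne (L : List ℤ) : Prop := ∀ n ∈ L, n = 0 ∨ n = -1

/-- The radical `r_{0,-1}(M)`. -/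
def radical (Y : V →ₗ[ℂ] VertexOperator ℂ V) (M : Submodule ℂ V) : Set V :=
  {v | ∃ m : ℕ, ∀ L : List ℤ, IsZeroNegOne L → m ≤ L.length → iterProd Y v L ∈ M}

/-- The left-strong radical `lsr_{0,-1}(M)`. -/
def leftStrongRadical (Y : V →ₗ[ℂ] VertexOperator ℂ V) (M : Submodule ℂ V) : Set V :=
  {v | ∀ b : V, ∃ m : ℕ, ∀ L : List ℤ, IsZeroNegOne L → m ≤ L.length →
    ∀ s : ℤ, s = 0 ∨ s = -1 → nthMode Y b s (iterProd Y v L) ∈ M}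

/-- The right-strong radical `rsr_{0,-1}(M)`. -/
def rightStrongRadical (Y : V →ₗ[ℂ] VertexOperator ℂ V) (M : Submodule ℂ V) : Set V :=
  {v | ∀ w : V, ∃ m : ℕ, ∀ L : List ℤ, IsZeroNegOne L → m ≤ L.length →
    ∀ n : ℤ, n = 0 ∨ n = -1 → nthMode Y (iterProd Y v L) n w ∈ M}

/-- The strong radical `sr_{0,-1}(M)`. -/
def strongRadical (Y : V →ₗ[ℂ] VertexOperator ℂ V) (M : Submodule ℂ V) : Set V :=
  leftStrongRadical Y M ∩ rightStrongRadical Y M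

/-- `M` is an `MZ_{0,-1}`-subspace: `r_{0,-1}(M) = sr_{0,-1}(M)`. -/
def IsMZSubspace (Y : V →ₗ[ℂ] VertexOperator ℂ V) (M : Submodule ℂ V) : Prop :=
  radical Y M = strongRadical Y M

end MZVertex

/-! ### The Heisenberg vertex operator algebra `M(1)` -/

namespace Heisenberg

open MvPolynomial

variable {ι : Type*}

/-- The Fock space `M(1)` of the vector space `𝔥` with orthonormal basis `(h_i)_{i : ι}`,
realized as the symmetric algebra on `t⁻¹𝔥[t⁻¹]`: the variable `X (i, n)`, `n ≥ 1`,
is `h_i(-n) 𝟏`, and the vacuum `𝟏` is the polynomial `1`. -/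
abbrev Fock (ι : Type*) : Type _ := MvPolynomial (ι × ℕ+) ℂ

/-- The operator `h_i(m) = h_i ⊗ t^m` on `M(1)`. For `m < 0` it is multiplication by
`X (i, -m)`, for `m > 0` it is `m ∂/∂X (i, m)`, and `h_i(0) = 0`. These satisfy
`[h_i(m), h_j(n)] = m δ_{i,j} δ_{m+n,0}`. -/
def mode (i : ι) : ℤ → Module.End ℂ (Fock ι)
  | Int.ofNat 0 => 0
  | Int.ofNat (k + 1) => ((k : ℂ) + 1) • (pderiv (R := ℂ) (i, k.succPNat)).toLinearMap
  | Int.negSucc k => LinearMap.mulLeft ℂ (X (i, k.succPNat) : Fock ι)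

/-- The normally ordered product of the operators `h_i(m)`, `(i, m)` in the list: the operators
with `m < 0` are placed to the left of those with `0 ≤ m`. -/
def normalOrder (L : List (ι × ℤ)) : Module.End ℂ (Fock ι) :=
  ((L.filter (fun a => a.2 < 0) ++ L.filter (fun a => 0 ≤ a.2)).map
    (fun a => mode a.1 a.2)).prod

/-- The coefficient of `h(m) z^(-m-n)` in `(1/(n-1)!) (d/dz)^(n-1) h(z)`, where
`h(z) = ∑ h(m) z^(-m-1)`; it is the generalized binomial coefficient of `-m-1` over `n-1`. -/
def fieldCoeff (n : ℕ+) (m : ℤ) : ℂ := ((Ring.choose (-m - 1) n.natPred : ℤ) : ℂ)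

/-- For `l = [(i₁, n₁), …, (i_k, n_k)]` and `m = (m₁, …, m_k)`, the contribution of the modes
`h_{i_j}(m_j)` to the normally ordered product of the fields
`(1/(n_j-1)!) (d/dz)^(n_j-1) h_{i_j}(z)`. -/
def fieldTerm (l : List (ι × ℕ+)) (m : Fin l.length → ℤ) : Module.End ℂ (Fock ι) :=
  (∏ j, fieldCoeff (l.get j).2 (m j)) • normalOrder (List.ofFn fun j => ((l.get j).1, m j))

/-- The mode tuples which contribute to the coefficient of `z^k`. -/
def modeTuples (l : List (ι × ℕ+)) (k : ℤ) : Set (Fin l.length → ℤ) :=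
  {m | ∑ j, (-m j - ((l.get j).2 : ℤ)) = k}

theorem exists_bound (w : Fock ι) :
    ∃ N : ℕ, w ∈ supported ℂ {q : ι × ℕ+ | (q.2 : ℕ) < N} := by
  refine ⟨w.vars.sup (fun q => (q.2 : ℕ)) + 1, ?_⟩
  rw [mem_supported]
  intro q hq
  exact Nat.lt_succ_of_le (Finset.le_sup (f := fun q : ι × ℕ+ => (q.2 : ℕ)) hq)

theorem pderiv_mem_supported (s : Set (ι × ℕ+)) (q : ι × ℕ+) {w : Fock ι}
    (hw : w ∈ supported ℂ s) : pderiv q w ∈ supported ℂ s := by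
  classical
  rw [supported] at hw
  induction hw using Algebra.adjoin_induction with
  | mem x hx =>
    obtain ⟨y, _, rfl⟩ := hx
    rw [pderiv_X, Pi.single_apply]
    split_ifs
    · exact one_mem _
    · exact zero_mem _
  | algebraMap r => simp [algebraMap_eq]
  | add x y _ _ hx hy => rw [map_add]; exact add_mem hx hy
  | mul x y hx' hy' hx hy =>
    rw [pderiv_mul]
    exact add_mem (mul_mem hx hy') (mul_mem hx' hy)

theorem mode_mem_supported (s : Set (ι × ℕ+)) (i : ι) {m : ℤ} (hm : 0 ≤ m) {w : Fock ι}
    (hw : w ∈ supported ℂ s) : mode i m w ∈ supported ℂ s := by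
  match m, hm with
  | Int.ofNat 0, _ => simp [mode]
  | Int.ofNat (k + 1), _ =>
    exact Subalgebra.smul_mem _ (pderiv_mem_supported s _ hw) _

theorem mode_eq_zero (i : ι) {N : ℕ} {m : ℤ} (hm : (N : ℤ) ≤ m) {w : Fock ι}
    (hw : w ∈ supported ℂ {q : ι × ℕ+ | (q.2 : ℕ) < N}) : mode i m w = 0 := by
  match m, hm with
  | Int.ofNat 0, _ => simp [mode]
  | Int.ofNat (k + 1), hm =>
    have h : pderiv (R := ℂ) (i, k.succPNat) w = 0 := by
      apply pderiv_eq_zero_of_notMem_vars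
      intro hv
      have := mem_supported.1 hw hv
      simp only [Set.mem_ofPred_eq, Nat.succPNat_coe] at this
      have h2 : (N : ℤ) ≤ ((k + 1 : ℕ) : ℤ) := hm
      omega
    simp [mode, h]
  | Int.negSucc k, hm => exact absurd hm (by have := Int.negSucc_lt_zero k; omega)

theorem prod_mode_mem (s : Set (ι × ℕ+)) {w : Fock ι} (hw : w ∈ supported ℂ s)
    (L : List (ι × ℤ)) (hL : ∀ a ∈ L, 0 ≤ a.2) :
    (L.map (fun a => mode a.1 a.2)).prod w ∈ supported ℂ s := by
  induction L with
  | nil => simpa using hw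
  | cons a L ih =>
    simp only [List.map_cons, List.prod_cons, Module.End.mul_apply]
    exact mode_mem_supported s _ (hL a (by simp)) (ih fun b hb => hL b (by simp [hb]))

theorem prod_mode_eq_zero {N : ℕ} {w : Fock ι}
    (hw : w ∈ supported ℂ {q : ι × ℕ+ | (q.2 : ℕ) < N})
    (L : List (ι × ℤ)) (hL : ∀ a ∈ L, 0 ≤ a.2) (h : ∃ a ∈ L, (N : ℤ) ≤ a.2) :
    (L.map (fun a => mode a.1 a.2)).prod w = 0 := by
  induction L with
  | nil => simp at h
  | cons a L ih =>
    simp only [List.map_cons, List.prod_cons, Module.End.mul_apply]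
    have hL' : ∀ b ∈ L, 0 ≤ b.2 := fun b hb => hL b (by simp [hb])
    obtain ⟨b, hb, hbN⟩ := h
    rcases List.mem_cons.1 hb with rfl | hb
    · exact mode_eq_zero _ hbN (prod_mode_mem _ hw L hL')
    · rw [ih hL' ⟨b, hb, hbN⟩, map_zero]

theorem normalOrder_eq_zero {N : ℕ} {w : Fock ι}
    (hw : w ∈ supported ℂ {q : ι × ℕ+ | (q.2 : ℕ) < N})
    (L : List (ι × ℤ)) (h : ∃ a ∈ L, (N : ℤ) ≤ a.2) : normalOrder L w = 0 := by
  obtain ⟨a, ha, haN⟩ := h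
  have h0 : (0 : ℤ) ≤ a.2 := le_trans (by positivity) haN
  rw [normalOrder, List.map_append, List.prod_append, Module.End.mul_apply,
    prod_mode_eq_zero hw _ (by simp) ⟨a, by simp [ha, h0], haN⟩, map_zero]

theorem fieldCoeff_eq_zero {n : ℕ+} {m : ℤ} (hm : m < 0) (h : -(n : ℤ) < m) :
    fieldCoeff n m = 0 := by
  obtain ⟨k, rfl⟩ := Int.eq_negSucc_of_lt_zero hm
  have h1 : -Int.negSucc k - 1 = (k : ℤ) := by rw [Int.neg_negSucc]; push_cast; ring
  have h2 : k < n.natPred := by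
    have := PNat.natPred_add_one n
    omega
  rw [fieldCoeff, h1, Ring.choose_natCast, Nat.choose_eq_zero_of_lt h2]
  simp

theorem fieldTerm_ne_zero {N : ℕ} {w : Fock ι}
    (hw : w ∈ supported ℂ {q : ι × ℕ+ | (q.2 : ℕ) < N})
    {l : List (ι × ℕ+)} {m : Fin l.length → ℤ} (h : fieldTerm l m w ≠ 0) (j : Fin l.length) :
    m j < N ∧ (m j < 0 → m j ≤ -((l.get j).2 : ℤ)) := by
  constructor
  · by_contra hj
    refine h ?_
    rw [fieldTerm, LinearMap.smul_apply, normalOrder_eq_zero hw _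
      ⟨((l.get j).1, m j), by rw [List.mem_ofFn]; exact ⟨j, rfl⟩, not_lt.1 hj⟩, smul_zero]
  · intro hneg
    by_contra hj
    refine h ?_
    rw [fieldTerm, LinearMap.smul_apply,
      Finset.prod_eq_zero (Finset.mem_univ j) (fieldCoeff_eq_zero hneg (not_le.1 hj)), zero_smul]

theorem finite_support (l : List (ι × ℕ+)) (k : ℤ) (w : Fock ι) :
    (modeTuples l k ∩ Function.support fun m => fieldTerm l m w).Finite := by
  obtain ⟨N, hN⟩ := exists_bound w
  refine (Set.finite_Icc (fun j : Fin l.length => -k - ((l.get j).2 : ℤ) -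
    ∑ _i : Fin l.length, ((N : ℤ) + ∑ i, ((l.get i).2 : ℤ))) (fun _ => (N : ℤ))).subset ?_
  rintro m ⟨hm, hs⟩
  have hb := fun j => (fieldTerm_ne_zero hN hs j).1
  refine ⟨fun j => ?_, fun j => (hb j).le⟩
  simp only [modeTuples, Set.mem_ofPred_eq] at hm
  rw [← Finset.add_sum_erase _ _ (Finset.mem_univ j)] at hm
  have h1 : ∑ i ∈ Finset.univ.erase j, (m i + ((l.get i).2 : ℤ)) ≤
      ∑ _i : Fin l.length, ((N : ℤ) + ∑ i, ((l.get i).2 : ℤ)) := by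
    refine (Finset.sum_le_sum (g := fun _ => (N : ℤ) + ∑ i, ((l.get i).2 : ℤ)) ?_).trans
      (Finset.sum_le_sum_of_subset_of_nonneg (Finset.subset_univ _) fun _ _ _ => by positivity)
    intro i _
    have := Finset.single_le_sum (f := fun i => ((l.get i).2 : ℤ)) (fun _ _ => by positivity)
      (Finset.mem_univ i)
    have := hb i
    linarith
  have h2 : ∑ i ∈ Finset.univ.erase j, (-m i - ((l.get i).2 : ℤ)) =
      -∑ i ∈ Finset.univ.erase j, (m i + ((l.get i).2 : ℤ)) := by
    rw [← Finset.sum_neg_distrib]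
    exact Finset.sum_congr rfl fun _ _ => by ring
  simp only at *
  linarith

/-- The coefficient of `z^k` in the normally ordered product of the fields
`(1/(n_j-1)!) (d/dz)^(n_j-1) h_{i_j}(z)`, `(i_j, n_j)` in the list `l`. Applied to a vector, only
finitely many terms of the sum are nonzero. -/
def zCoeff (l : List (ι × ℕ+)) (k : ℤ) : Module.End ℂ (Fock ι) where
  toFun w := ∑ᶠ m ∈ modeTuples l k, fieldTerm l m w
  map_add' u w := by
    simp only [map_add]
    exact finsum_mem_add_distrib' (finite_support l k u) (finite_support l k w)
  map_smul' c w := by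
    simp only [map_smul, RingHom.id_apply]
    exact ((DistribSMul.toAddMonoidHom (Fock ι) c).map_finsum_mem'
      (finite_support l k w)).symm

theorem bddBelow_zCoeff (l : List (ι × ℕ+)) (w : Fock ι) :
    BddBelow (Function.support fun k => zCoeff l k w) := by
  obtain ⟨N, hN⟩ := exists_bound w
  refine ⟨∑ j, (-(N : ℤ) - ((l.get j).2 : ℤ)), fun k hk => ?_⟩
  by_contra hlt
  refine hk (finsum_mem_eq_zero_of_forall_eq_zero fun m hm => ?_)
  by_contra hne
  refine hlt ?_
  rw [← show _ = k from hm]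
  exact Finset.sum_le_sum fun j _ => by
    have := (fieldTerm_ne_zero hN hne j).1
    linarith

/-- The vertex operator of the monomial `h_{i₁}(-n₁) ⋯ h_{i_k}(-n_k) 𝟏`, with
`l = [(i₁, n₁), …, (i_k, n_k)]`: the normally ordered product of the fields
`(1/(n_j-1)!) (d/dz)^(n_j-1) h_{i_j}(z)`. -/
def monomialField (l : List (ι × ℕ+)) : VertexOperator ℂ (Fock ι) :=
  VertexOperator.of_coeff (zCoeff l) (bddBelow_zCoeff l)

/-- The vertex operator map `v ↦ Y(v, z)` of `M(1)`, extended linearly from the monomials. The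
order in which the variables of a monomial are listed is irrelevant, since the `h_i(m)` with
`m < 0` commute with each other, and so do those with `0 ≤ m`. -/
def Y (ι : Type*) : Fock ι →ₗ[ℂ] VertexOperator ℂ (Fock ι) :=
  (basisMonomials (ι × ℕ+) ℂ).constr ℂ fun s => monomialField (Finsupp.toMultiset s).toList

/-- The vector `h_i(-1) 𝟏` of `M(1)`, identified with `h_i`. -/
def gen (i : ι) : Fock ι := X (i, 1)

/-- Let `𝔥` have the orthonormal basis `β¹, …, βⁿ, α¹, …, αⁿ`, where `β^i` is indexed by
`Sum.inl i` and `α^i` by `Sum.inr i`. This is the map `f_i = β^i_1 - α^i_{-1}` on `M(1)`. -/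
def fMap {n : ℕ} (i : Fin n) : Module.End ℂ (Fock (Fin n ⊕ Fin n)) :=
  MZVertex.nthMode (Y (Fin n ⊕ Fin n)) (gen (Sum.inl i)) 1 -
    MZVertex.nthMode (Y (Fin n ⊕ Fin n)) (gen (Sum.inr i)) (-1)

/-- The subspace `∑_{i=1}^n f_i(M(1)) + C₂(M(1))` of `M(1)`. -/
def imageSubspace (n : ℕ) : Submodule ℂ (Fock (Fin n ⊕ Fin n)) :=
  (⨆ i : Fin n, LinearMap.range (fMap i)) ⊔ MZVertex.cTwo (Y (Fin n ⊕ Fin n))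

end Heisenberg

/-- The Jacobian matrix `(∂φ(x_i)/∂x_j)` of an endomorphism `φ` of `ℂ[x₁, …, x_n]`. -/
def jacobianMatrix {n : ℕ} (φ : MvPolynomial (Fin n) ℂ →ₐ[ℂ] MvPolynomial (Fin n) ℂ) :
    Matrix (Fin n) (Fin n) (MvPolynomial (Fin n) ℂ) :=
  Matrix.of fun i j => MvPolynomial.pderiv j (φ (MvPolynomial.X i))

end

/-! The vertex-algebra hypothesis collapses to a statement about polynomials, which inverts Keller
maps. Let E : ℂ[x, ξ] → ℂ[x] be ξ^p x^q ↦ ∂^p x^q (`imageEval`); its kernel is the sum of the images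
of the operators ∂/∂x_i - ξ_i (`imageEval_eq_zero_iff`).

Setting the variables h(-m), m ≥ 2, to zero maps M(1) onto ℂ[x, ξ]. Under this map u_0 and u_{-2}
become 0 and u_{-1} becomes multiplication, so the given subspace is the preimage of ker E. The MZ
condition therefore yields: if E(P^m) = 0 for all m ≥ 1, then for each g, E(g P^m) = 0 for large m
(`Heisenberg.hasImageProperty_of_isMZSubspace`).

Take P = f = ∑ ξ_i H_i. If all powers of the Jacobian matrix JH have trace zero, then E(f^m) = 0 for
m ≥ 1 (`imageEval_xiDot_pow_succ_eq_zero`). The series ∑ t^m/m! E(a f^m) then inverts the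
substitution x ↦ x - tH. The image property with g = x_i makes this series a polynomial in t, and t
= 1 shows that x ↦ x - H is onto (`surjective_aeval_X_sub`).

For a general map with det(1 - JH) = 1 and H of order at least 2, JH need not be nilpotent. Adding
variables, one block per homogeneous component of H, replaces H by a map whose Jacobian is a block
companion matrix, and this one is nilpotent (`surjective_of_det_one_sub_polyJacobian`). An affine
change of coordinates brings every Keller map to this form, and a surjective endomorphism of a
Noetherian ring is bijective. -/

/-! ### The evaluation ξ^p x^q ↦ ∂^p x^q and its kernel. -/

section ImageEval

open MvPolynomial

variable {σ : Type*} [Fintype σ]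

/-- The linear map `ℂ[x, ξ] → ℂ[x]`, `ξ^p x^q ↦ ∂^p x^q`, where `x i` is `X (Sum.inl i)` and `ξ i` is
`X (Sum.inr i)`. -/
noncomputable def imageEval (σ : Type*) [Fintype σ] :
    MvPolynomial (σ ⊕ σ) ℂ →ₗ[ℂ] MvPolynomial σ ℂ :=
  (basisMonomials (σ ⊕ σ) ℂ).constr ℂ fun s =>
    -- If some ξ-exponent exceeds the x-exponent, the truncated exponent is meaningless, but the
    -- falling factorial in the coefficient is then 0.
    monomial (Finsupp.equivFunOnFinite.symm fun i => s (Sum.inl i) - s (Sum.inr i))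
      (∏ i, ((s (Sum.inl i)).descFactorial (s (Sum.inr i)) : ℂ))

theorem imageEval_monomial (s : σ ⊕ σ →₀ ℕ) (a : ℂ) :
    imageEval σ (monomial s a) =
      monomial (Finsupp.equivFunOnFinite.symm fun i => s (Sum.inl i) - s (Sum.inr i))
        (a * ∏ i, ((s (Sum.inl i)).descFactorial (s (Sum.inr i)) : ℂ)) := by
  have h : monomial s a = a • basisMonomials (σ ⊕ σ) ℂ s := by
    simp [smul_monomial]
  rw [h, map_smul, imageEval, Module.Basis.constr_basis, smul_monomial, smul_eq_mul]

/-- An extra factor ξ_i means one more derivative ∂_i, which may be applied to the x-part first. -/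
theorem imageEval_X_inr_mul (i : σ) (w : MvPolynomial (σ ⊕ σ) ℂ) :
    imageEval σ (X (Sum.inr i) * w) = imageEval σ (pderiv (Sum.inl i) w) := by
  classical
  induction w using MvPolynomial.induction_on' with
  | add p q hp hq => rw [mul_add, map_add, map_add, map_add, hp, hq]
  | monomial s a =>
    rw [X, monomial_mul, one_mul, pderiv_monomial, imageEval_monomial, imageEval_monomial]
    have hd : ∀ p q : ℕ, q.descFactorial (1 + p) = q * (q - 1).descFactorial p := by
      intro p q
      rw [add_comm]
      cases q with
      | zero => simp
      | succ q => rw [Nat.succ_descFactorial_succ]; rfl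
    have he : ∀ j ∈ Finset.univ.erase i, j ≠ i := fun j hj => Finset.ne_of_mem_erase hj
    congr 1
    · congr 1
      ext j
      by_cases hj : j = i
      · subst hj; simp; omega
      · simp [Finsupp.single_apply, Ne.symm hj]
    · rw [mul_assoc, ← Finset.mul_prod_erase _ _ (Finset.mem_univ i),
        ← Finset.mul_prod_erase _ _ (Finset.mem_univ i), ← mul_assoc (s (Sum.inl i) : ℂ)]
      congr 2
      · simp [hd]
      · refine Finset.prod_congr rfl fun j hj => ?_
        simp [Ne.symm (he j hj)]

/-- This is the commutation rule ∂^p x = x ∂^p + p ∂^(p-1), with p ∂^(p-1) read as the ξ-derivative.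
-/
theorem imageEval_X_inl_mul (i : σ) (w : MvPolynomial (σ ⊕ σ) ℂ) :
    imageEval σ (X (Sum.inl i) * w) =
      X i * imageEval σ w + imageEval σ (pderiv (Sum.inr i) w) := by
  classical
  induction w using MvPolynomial.induction_on' with
  | add p q hp hq => simp only [mul_add, map_add, hp, hq]; ring
  | monomial s a =>
    rw [X, X, monomial_mul, one_mul, pderiv_monomial, imageEval_monomial, imageEval_monomial,
      imageEval_monomial, monomial_mul, one_mul]
    have he : ∀ j ∈ Finset.univ.erase i, j ≠ i := fun j hj => Finset.ne_of_mem_erase hj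
    simp only [← Finset.mul_prod_erase _ _ (Finset.mem_univ i)]
    have h1 : ∏ j ∈ Finset.univ.erase i, ((((fun₀ | Sum.inl i => 1) + s) (Sum.inl j)).descFactorial
        (((fun₀ | Sum.inl i => 1) + s) (Sum.inr j)) : ℂ) =
        ∏ j ∈ Finset.univ.erase i, ((s (Sum.inl j)).descFactorial (s (Sum.inr j)) : ℂ) :=
      Finset.prod_congr rfl fun j hj => by simp [Ne.symm (he j hj)]
    have h2 : ∏ j ∈ Finset.univ.erase i, (((s - (fun₀ | Sum.inr i => 1)) (Sum.inl j)).descFactorial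
        ((s - (fun₀ | Sum.inr i => 1)) (Sum.inr j)) : ℂ) =
        ∏ j ∈ Finset.univ.erase i, ((s (Sum.inl j)).descFactorial (s (Sum.inr j)) : ℂ) :=
      Finset.prod_congr rfl fun j hj => by simp [Ne.symm (he j hj)]
    rw [h1, h2]
    generalize ∏ j ∈ Finset.univ.erase i, ((s (Sum.inl j)).descFactorial (s (Sum.inr j)) : ℂ) = K
    have hE : s (Sum.inr i) ≤ s (Sum.inl i) →
        (fun₀ | i => 1) + Finsupp.equivFunOnFinite.symm
          (fun j => s (Sum.inl j) - s (Sum.inr j)) =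
        Finsupp.equivFunOnFinite.symm (fun j => ((fun₀ | Sum.inl i => 1) + s) (Sum.inl j) -
          ((fun₀ | Sum.inl i => 1) + s) (Sum.inr j)) := by
      intro h
      ext j
      by_cases hj : j = i
      · subst hj; simp; omega
      · simp [Finsupp.single_apply, Ne.symm hj]
    have hE' : s (Sum.inr i) ≠ 0 →
        Finsupp.equivFunOnFinite.symm (fun j => (s - (fun₀ | Sum.inr i => 1)) (Sum.inl j) -
          (s - (fun₀ | Sum.inr i => 1)) (Sum.inr j)) =
        Finsupp.equivFunOnFinite.symm (fun j => ((fun₀ | Sum.inl i => 1) + s) (Sum.inl j) -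
          ((fun₀ | Sum.inl i => 1) + s) (Sum.inr j)) := by
      intro h
      ext j
      by_cases hj : j = i
      · subst hj; simp; omega
      · simp [Finsupp.single_apply, Ne.symm hj]
    -- With p the ξ_i-exponent and q the x_i-exponent, the truncated subtractions agree only for
    -- suitable p and q. The cases are p = 0, 0 < p ≤ q, and p > q; in the last, the surviving terms
    -- are nonzero only for p = q + 1.
    by_cases h0 : s (Sum.inr i) = 0
    · rw [hE (by omega)]
      simp [h0]
    · rw [hE' h0]
      obtain ⟨p, hp⟩ := Nat.exists_eq_succ_of_ne_zero h0
      by_cases hle : s (Sum.inr i) ≤ s (Sum.inl i)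
      · rw [hE hle, ← map_add]
        congr 1
        obtain ⟨d, hd⟩ := Nat.exists_eq_add_of_le hle
        simp only [Finsupp.add_apply, Finsupp.single_eq_same, Finsupp.tsub_apply, ne_eq,
          reduceCtorEq, not_false_eq_true, Finsupp.single_eq_of_ne, zero_add, tsub_zero, hp]
        rw [add_comm 1, Nat.succ_descFactorial_succ, Nat.descFactorial_succ, Nat.succ_sub_one]
        rw [hd, hp, show p.succ + d - p = d + 1 by omega]
        push_cast
        ring
      · have hz : (s (Sum.inl i)).descFactorial (s (Sum.inr i)) = 0 :=
          Nat.descFactorial_eq_zero_iff_lt.2 (not_le.1 hle)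
        rw [hz]
        simp only [Nat.cast_zero, zero_mul, mul_zero, map_zero, zero_add]
        congr 1
        simp only [Finsupp.add_apply, Finsupp.single_eq_same, Finsupp.tsub_apply, ne_eq,
          reduceCtorEq, not_false_eq_true, Finsupp.single_eq_of_ne, zero_add, tsub_zero, hp]
        rw [add_comm 1, Nat.succ_descFactorial_succ, Nat.succ_sub_one]
        by_cases hq : s (Sum.inl i) = p
        · rw [hq]; push_cast; ring
        · rw [Nat.descFactorial_eq_zero_iff_lt.2 (by omega)]; simp

theorem imageEval_rename_inl (g : MvPolynomial σ ℂ) :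
    imageEval σ (rename Sum.inl g) = g := by
  induction g using MvPolynomial.induction_on' with
  | monomial s a =>
    have hi : ∀ i, (s.mapDomain Sum.inl : σ ⊕ σ →₀ ℕ) (Sum.inl i) = s i := fun i =>
      Finsupp.mapDomain_apply Sum.inl_injective _ _
    have hr : ∀ i, (s.mapDomain Sum.inl : σ ⊕ σ →₀ ℕ) (Sum.inr i) = 0 := fun i =>
      Finsupp.mapDomain_of_notMem_range _ _ (by simp)
    rw [rename_monomial, imageEval_monomial]
    simp only [hi, hr, Nat.descFactorial_zero, Nat.cast_one, Finset.prod_const_one, mul_one,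
      tsub_zero]
    congr 1
    ext; simp
  | add p q hp hq => rw [map_add, map_add, hp, hq]

/-- The operator `∂/∂x i - ξ i` on `ℂ[x, ξ]`. -/
noncomputable def imageOp (i : σ) : Module.End ℂ (MvPolynomial (σ ⊕ σ) ℂ) :=
  (pderiv (R := ℂ) (Sum.inl i)).toLinearMap - LinearMap.mulLeft ℂ (X (Sum.inr i))

theorem imageOp_apply {σ : Type*} (i : σ) (w : MvPolynomial (σ ⊕ σ) ℂ) :
    imageOp i w = pderiv (Sum.inl i) w - X (Sum.inr i) * w := rfl

theorem imageEval_imageOp (i : σ) (w : MvPolynomial (σ ⊕ σ) ℂ) :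
    imageEval σ (imageOp i w) = 0 := by
  rw [imageOp_apply, map_sub, imageEval_X_inr_mul, sub_self]

/-- Modulo the images, ξ_i m is congruent to ∂m/∂x_i, which has smaller ξ-degree and the same value
under E. Iterating removes every ξ. -/
theorem sub_rename_imageEval_mem (w : MvPolynomial (σ ⊕ σ) ℂ) :
    w - rename Sum.inl (imageEval σ w) ∈ ⨆ i : σ, LinearMap.range (imageOp i) := by
  classical
  have key : ∀ (n : ℕ) (s : σ ⊕ σ →₀ ℕ) (a : ℂ), ∑ i, s (Sum.inr i) = n →
      monomial s a - rename Sum.inl (imageEval σ (monomial s a)) ∈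
        ⨆ i : σ, LinearMap.range (imageOp i) := by
    intro n
    induction n with
    | zero =>
      intro s a hs
      have hs0 : ∀ i, s (Sum.inr i) = 0 := fun i => by
        have := (Finset.sum_eq_zero_iff.1 hs) i (Finset.mem_univ i)
        exact this
      have h : monomial s a = rename Sum.inl
          (monomial (Finsupp.equivFunOnFinite.symm fun i => s (Sum.inl i)) a) := by
        rw [rename_monomial]
        refine congrArg (fun t => monomial t a) ?_
        ext (j | j)
        · rw [Finsupp.mapDomain_apply Sum.inl_injective]; simp
        · rw [Finsupp.mapDomain_of_notMem_range _ _ (by simp), hs0]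
      rw [h, imageEval_rename_inl, sub_self]
      exact zero_mem _
    | succ n ih =>
      intro s a hs
      obtain ⟨i, hi⟩ : ∃ i, s (Sum.inr i) ≠ 0 := by
        by_contra hcon
        push Not at hcon
        simp [hcon] at hs
      set t := s - Finsupp.single (Sum.inr i) 1 with ht
      have hst : s = Finsupp.single (Sum.inr i) 1 + t := by
        rw [ht, add_tsub_cancel_of_le]
        rw [Finsupp.single_le_iff]
        omega
      have hX : monomial s a = X (Sum.inr i) * monomial t a := by
        rw [X, monomial_mul, one_mul, ← hst]
      have htn : ∑ j, t (Sum.inr j) = n := by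
        rw [hst] at hs
        simp only [Finsupp.add_apply, Finset.sum_add_distrib] at hs
        have : ∑ j : σ, (Finsupp.single (Sum.inr i) 1 : σ ⊕ σ →₀ ℕ) (Sum.inr j) = 1 := by
          simp [Finsupp.single_apply]
        omega
      have h1 : X (Sum.inr i) * monomial t a - pderiv (Sum.inl i) (monomial t a) ∈
          ⨆ i : σ, LinearMap.range (imageOp i) := by
        rw [← neg_sub, ← imageOp_apply]
        exact neg_mem (Submodule.mem_iSup_of_mem i ⟨_, rfl⟩)
      have h2 := ih (t - Finsupp.single (Sum.inl i) 1) (a * t (Sum.inl i)) (by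
        rw [← htn]
        exact Finset.sum_congr rfl fun j _ => by simp)
      rw [← pderiv_monomial] at h2
      rw [hX, imageEval_X_inr_mul]
      simpa using add_mem h1 h2
  induction w using MvPolynomial.induction_on' with
  | monomial s a => exact key _ s a rfl
  | add p q hp hq =>
    have := add_mem hp hq
    rwa [sub_add_sub_comm, ← map_add, ← map_add] at this

theorem imageEval_eq_zero_iff {w : MvPolynomial (σ ⊕ σ) ℂ} :
    imageEval σ w = 0 ↔ w ∈ ⨆ i : σ, LinearMap.range (imageOp i) := by
  constructor
  · intro h
    simpa [h] using sub_rename_imageEval_mem w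
  · intro h
    have hle : (⨆ i : σ, LinearMap.range (imageOp i)) ≤ LinearMap.ker (imageEval σ) := by
      refine iSup_le fun i => ?_
      rintro _ ⟨v, rfl⟩
      exact imageEval_imageOp i v
    exact hle h

theorem imageEval_rename_equiv {τ : Type*} [Fintype τ] (e : σ ≃ τ)
    (w : MvPolynomial (σ ⊕ σ) ℂ) :
    imageEval τ (rename (Sum.map e e) w) = rename e (imageEval σ w) := by
  induction w using MvPolynomial.induction_on' with
  | add p q hp hq => simp only [map_add, hp, hq]
  | monomial s a =>
    have hinj : Function.Injective (Sum.map e e) := e.injective.sumMap e.injective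
    have hl : ∀ i, s.mapDomain (Sum.map e e) (Sum.inl i) = s (Sum.inl (e.symm i)) := fun i => by
      simpa using Finsupp.mapDomain_apply hinj s (Sum.inl (e.symm i))
    have hr : ∀ i, s.mapDomain (Sum.map e e) (Sum.inr i) = s (Sum.inr (e.symm i)) := fun i => by
      simpa using Finsupp.mapDomain_apply hinj s (Sum.inr (e.symm i))
    rw [rename_monomial, imageEval_monomial, imageEval_monomial, rename_monomial]
    simp only [hl, hr]
    congr 1
    · congr 1
      ext j
      obtain ⟨i, rfl⟩ := e.surjective j
      rw [Finsupp.mapDomain_apply e.injective]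
      simp
    · congr 1
      exact Equiv.prod_comp e.symm
        (fun i => ((s (Sum.inl i)).descFactorial (s (Sum.inr i)) : ℂ))

/-- The image of the operators `∂/∂x i - ξ i` is a Mathieu subspace of `ℂ[x, ξ]`. -/
def HasImageProperty (σ : Type*) [Fintype σ] : Prop :=
  ∀ P : MvPolynomial (σ ⊕ σ) ℂ, (∀ m : ℕ, imageEval σ (P ^ (m + 1)) = 0) →
    ∀ g : MvPolynomial (σ ⊕ σ) ℂ, ∃ N : ℕ, ∀ m, N ≤ m → imageEval σ (g * P ^ m) = 0

theorem HasImageProperty.of_equiv {τ : Type*} [Fintype τ] (e : σ ≃ τ)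
    (h : HasImageProperty τ) : HasImageProperty σ := by
  intro P hP g
  obtain ⟨N, hN⟩ := h (rename (Sum.map e e) P)
    (fun m => by rw [← map_pow, imageEval_rename_equiv, hP, map_zero]) (rename (Sum.map e e) g)
  refine ⟨N, fun m hm => rename_injective e e.injective ?_⟩
  rw [← imageEval_rename_equiv, map_mul, map_pow, hN m hm, map_zero]

end ImageEval

/-! ### Divergence-free fields from a Jacobian matrix with traceless powers. -/

section Divergence

open MvPolynomial

theorem MvPolynomial.pderiv_comm {σ R : Type*} [CommRing R] (i j : σ) (p : MvPolynomial σ R) :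
    pderiv i (pderiv j p) = pderiv j (pderiv i p) := by
  classical
  have h : ⁅pderiv (R := R) i, pderiv (R := R) j⁆ = 0 := by
    refine derivation_ext fun k => ?_
    rw [Derivation.commutator_apply]
    simp [pderiv_X, Pi.single_apply, apply_ite]
  have := congrArg (fun D => D p) h
  rw [Derivation.commutator_apply] at this
  exact sub_eq_zero.1 this

variable {σ R A : Type*} [Fintype σ] [CommRing R] [CommRing A] [Algebra R A]

theorem Matrix.map_derivation_mul (D : Derivation R A A) (M N : Matrix σ σ A) :
    (M * N).map D = M.map D * N + M * N.map D := by
  ext i j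
  simp only [Matrix.map_apply, Matrix.mul_apply, Matrix.add_apply, map_sum, Derivation.leibniz,
    smul_eq_mul, ← Finset.sum_add_distrib]
  exact Finset.sum_congr rfl fun k _ => by ring

/-- By the Leibniz rule and cyclicity of the trace, each factor of N contributes the same term. -/
theorem Matrix.trace_pow_mul_map_derivation_pow [DecidableEq σ] (D : Derivation R A A)
    (N : Matrix σ σ A) (a b : ℕ) :
    (N ^ a * (N ^ (b + 1)).map D).trace = (b + 1) * (N ^ (a + b) * N.map D).trace := by
  induction b generalizing a with
  | zero => simp
  | succ b ih =>
    rw [pow_succ N (b + 1), Matrix.map_derivation_mul, mul_add, Matrix.trace_add, ← mul_assoc,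
      Matrix.trace_mul_comm, ← mul_assoc, ← pow_succ', ih, ← mul_assoc, ← pow_add,
      show a + 1 + b = a + (b + 1) by ring]
    push_cast
    ring

/-- The derivative of tr N^(s+1) is (s + 1) tr(N^s DN), and s + 1 is invertible enough in
characteristic zero. -/
theorem Matrix.trace_pow_mul_map_derivation_eq_zero [DecidableEq σ] [IsDomain A] [CharZero A]
    (D : Derivation R A A) {N : Matrix σ σ A} (hN : ∀ k : ℕ, (N ^ (k + 1)).trace = 0) (s : ℕ) :
    (N ^ s * N.map D).trace = 0 := by
  have h := Matrix.trace_pow_mul_map_derivation_pow D N 0 s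
  have h0 : ((N ^ (s + 1)).map D).trace = D (N ^ (s + 1)).trace := by
    simp [Matrix.trace]
  rw [pow_zero, one_mul, h0, hN, map_zero, zero_add] at h
  exact (mul_eq_zero.1 h.symm).resolve_left (by exact_mod_cast s.succ_ne_zero)

variable [DecidableEq σ]

/-- The Jacobian matrix `(∂(H i)/∂x j)` of a polynomial map. -/
noncomputable def polyJacobian (H : σ → MvPolynomial σ ℂ) : Matrix σ σ (MvPolynomial σ ℂ) :=
  Matrix.of fun i j => pderiv j (H i)

variable {H : σ → MvPolynomial σ ℂ}

/-- Splitting N^(r+1) = N · N^r, the Leibniz rule gives a term with ∂N, which is a vanishing trace,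
and a term of the same shape with (r, s + 1). The case s = 0 says that the columns of N^r are
divergence-free. -/
theorem sum_pow_mul_pderiv_pow_eq_zero
    (hN : ∀ k : ℕ, (polyJacobian H ^ (k + 1)).trace = 0) (r s : ℕ) (k : σ) :
    ∑ i, ∑ l, (polyJacobian H ^ s) i l * pderiv i ((polyJacobian H ^ r) l k) = 0 := by
  induction r generalizing s with
  | zero =>
    refine Finset.sum_eq_zero fun i _ => Finset.sum_eq_zero fun l _ => ?_
    rw [pow_zero, Matrix.one_apply]
    split_ifs <;> simp
  | succ r ih =>
    set N := polyJacobian H with hNdef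
    -- Symmetry of second derivatives turns ∂_i N_{lm} into ∂_m N_{li}, so the sum is tr(N^s ∂_m N).
    have h1 : ∀ m, ∑ i, ∑ l, (N ^ s) i l * pderiv i (N l m) = 0 := by
      intro m
      rw [← Matrix.trace_pow_mul_map_derivation_eq_zero (pderiv (R := ℂ) m) hN s, Matrix.trace]
      refine Finset.sum_congr rfl fun i _ => ?_
      rw [Matrix.diag_apply, Matrix.mul_apply]
      refine Finset.sum_congr rfl fun l _ => ?_
      rw [Matrix.map_apply, hNdef, polyJacobian, Matrix.of_apply, Matrix.of_apply, pderiv_comm]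
    have h2 : ∀ i l, (N ^ s) i l * pderiv i ((N ^ (r + 1)) l k) =
        ∑ m, ((N ^ s) i l * pderiv i (N l m)) * (N ^ r) m k +
        ∑ m, ((N ^ s) i l * N l m) * pderiv i ((N ^ r) m k) := by
      intro i l
      rw [pow_succ', Matrix.mul_apply, map_sum, Finset.mul_sum, ← Finset.sum_add_distrib]
      refine Finset.sum_congr rfl fun m _ => ?_
      rw [pderiv_mul]
      ring
    have h3 : ∑ i, ∑ l, ∑ m, ((N ^ s) i l * pderiv i (N l m)) * (N ^ r) m k = 0 := by
      have : ∑ m, (∑ i, ∑ l, (N ^ s) i l * pderiv i (N l m)) * (N ^ r) m k = 0 :=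
        Finset.sum_eq_zero fun m _ => by rw [h1, zero_mul]
      rw [← this]
      simp only [Finset.sum_mul]
      rw [Finset.sum_comm (s := Finset.univ (α := σ))]
      conv_rhs => rw [Finset.sum_comm]
      rw [Finset.sum_comm]
      exact Finset.sum_congr rfl fun i _ => Finset.sum_comm
    have h4 : ∑ i, ∑ l, ∑ m, ((N ^ s) i l * N l m) * pderiv i ((N ^ r) m k) = 0 := by
      rw [← ih (s + 1)]
      refine Finset.sum_congr rfl fun i _ => ?_
      rw [Finset.sum_comm]
      refine Finset.sum_congr rfl fun m _ => ?_
      rw [pow_succ, Matrix.mul_apply, Finset.sum_mul]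
    simp only [h2, Finset.sum_add_distrib, h3, h4, add_zero]

/-- The divergence of N^r H is the columnwise divergence of N^r paired with H, plus tr N^(r+1). -/
theorem div_pow_mulVec_eq_zero
    (hN : ∀ k : ℕ, (polyJacobian H ^ (k + 1)).trace = 0) (r : ℕ) :
    ∑ i, pderiv i ((polyJacobian H ^ r).mulVec H i) = 0 := by
  have h0 : ∀ k, ∑ i, pderiv i ((polyJacobian H ^ r) i k) = 0 := by
    intro k
    have := sum_pow_mul_pderiv_pow_eq_zero hN r 0 k
    simpa [Matrix.one_apply] using this
  have h1 := hN r
  simp only [pow_succ, Matrix.trace, Matrix.diag_apply, Matrix.mul_apply] at h1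
  simp only [Matrix.mulVec, dotProduct, map_sum, pderiv_mul, Finset.sum_add_distrib]
  rw [Finset.sum_comm]
  simp only [← Finset.sum_mul, h0, zero_mul, Finset.sum_const_zero, zero_add]
  exact h1

end Divergence

/-! ### E annihilates the positive powers of ∑ ξ_i H_i. -/

section Vanishing

open MvPolynomial

variable {σ : Type*} [Fintype σ]

/-- The polynomial `∑ ξ i * a i(x)` in `ℂ[x, ξ]`. -/
noncomputable def xiDot (a : σ → MvPolynomial σ ℂ) : MvPolynomial (σ ⊕ σ) ℂ :=
  ∑ i, X (Sum.inr i) * rename Sum.inl (a i)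

theorem pderiv_inl_xiDot (a : σ → MvPolynomial σ ℂ) (i : σ) :
    pderiv (Sum.inl i) (xiDot a) = xiDot fun k => pderiv i (a k) := by
  simp [xiDot, pderiv_rename Sum.inl_injective, pderiv_X_of_ne]

theorem pderiv_inr_rename_inl {σ : Type*} (g : MvPolynomial σ ℂ) (i : σ) :
    pderiv (Sum.inr i) (rename (Sum.inl : σ → σ ⊕ σ) g) = 0 := by
  classical
  apply pderiv_eq_zero_of_notMem_vars
  intro h
  have := vars_rename _ _ h
  simp at this

theorem pderiv_inr_xiDot (a : σ → MvPolynomial σ ℂ) (i : σ) :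
    pderiv (Sum.inr i) (xiDot a) = rename Sum.inl (a i) := by
  classical
  simp [xiDot, pderiv_inr_rename_inl, pderiv_X, Pi.single_apply]

/-- Each ξ_i in the last factor is traded for ∂/∂x_i, which falls on the power (giving JH · a) or on
a (giving its divergence). At m = 0 the truncated exponent m - 1 carries the coefficient 0. -/
theorem imageEval_pow_mul_xiDot [DecidableEq σ] (H a : σ → MvPolynomial σ ℂ) (m : ℕ) :
    imageEval σ (xiDot H ^ m * xiDot a) =
      m * imageEval σ (xiDot H ^ (m - 1) * xiDot ((polyJacobian H).mulVec a)) +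
      imageEval σ (xiDot H ^ m * rename Sum.inl (∑ i, pderiv i (a i))) := by
  have h1 : xiDot H ^ m * xiDot a =
      ∑ i, X (Sum.inr i) * (xiDot H ^ m * rename Sum.inl (a i)) := by
    rw [xiDot.eq_def a, Finset.mul_sum]
    exact Finset.sum_congr rfl fun i _ => by ring
  have h2 : ∑ i, xiDot (fun k => pderiv i (H k)) * rename Sum.inl (a i) =
      xiDot ((polyJacobian H).mulVec a) := by
    simp only [xiDot, Finset.sum_mul, Matrix.mulVec, dotProduct, map_sum, Finset.mul_sum]
    rw [Finset.sum_comm]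
    refine Finset.sum_congr rfl fun i _ => Finset.sum_congr rfl fun k _ => ?_
    simp [polyJacobian, mul_assoc]
  have h3 : ∑ i, pderiv (Sum.inl i) (xiDot H ^ m * rename Sum.inl (a i)) =
      (m : ℂ) • (xiDot H ^ (m - 1) * xiDot ((polyJacobian H).mulVec a)) +
      xiDot H ^ m * rename Sum.inl (∑ i, pderiv i (a i)) := by
    rw [← h2, map_sum, Finset.mul_sum, Finset.mul_sum, Finset.smul_sum, ← Finset.sum_add_distrib]
    refine Finset.sum_congr rfl fun i _ => ?_
    rw [pderiv_mul, pderiv_pow, pderiv_inl_xiDot, pderiv_rename Sum.inl_injective, smul_eq_C_mul,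
      map_natCast]
    ring
  rw [h1, map_sum]
  simp only [imageEval_X_inr_mul]
  rw [← map_sum, h3, map_add, map_smul, smul_eq_C_mul, map_natCast]

theorem imageEval_xiDot_pow_succ_eq_zero [DecidableEq σ] {H : σ → MvPolynomial σ ℂ}
    (hN : ∀ k : ℕ, (polyJacobian H ^ (k + 1)).trace = 0) (m : ℕ) :
    imageEval σ (xiDot H ^ (m + 1)) = 0 := by
  -- All the fields (JH)^r H are treated at once: they are divergence-free, so lowering m by one
  -- only raises r by one.
  have key : ∀ m r : ℕ,
      imageEval σ (xiDot H ^ m * xiDot ((polyJacobian H ^ r).mulVec H)) = 0 := by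
    intro m
    induction m with
    | zero => intro r; rw [imageEval_pow_mul_xiDot, div_pow_mulVec_eq_zero hN]; simp
    | succ m ih =>
      intro r
      rw [imageEval_pow_mul_xiDot, div_pow_mulVec_eq_zero hN, Matrix.mulVec_mulVec, ← pow_succ',
        Nat.add_sub_cancel, ih]
      simp
  simpa [pow_succ] using key m 0

end Vanishing

/-! ### Formal inversion of x - tH, and its polynomiality. -/

section Inversion

open MvPolynomial

variable {σ : Type*} [Fintype σ]

/-- The formal series `∑ t^m/m! E(a f^m)` for `f = ∑ ξ i * H i`. -/
noncomputable def inversionSeries (H : σ → MvPolynomial σ ℂ) :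
    MvPolynomial σ ℂ →ₗ[ℂ] PowerSeries (MvPolynomial σ ℂ) where
  toFun a := PowerSeries.mk fun m =>
    (m.factorial : ℂ)⁻¹ • imageEval σ (rename Sum.inl a * xiDot H ^ m)
  map_add' a b := by ext1 m; simp [add_mul]
  map_smul' c a := by ext1 m; simp [smul_comm c]

theorem coeff_inversionSeries (H : σ → MvPolynomial σ ℂ) (a : MvPolynomial σ ℂ) (m : ℕ) :
    PowerSeries.coeff m (inversionSeries H a) =
      (m.factorial : ℂ)⁻¹ • imageEval σ (rename Sum.inl a * xiDot H ^ m) := by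
  simp [inversionSeries]

/-- The ξ_i-derivative of f^m/m! is H_i f^(m-1)/(m-1)!, whence the shift by t. Rearranged,
multiplying the argument by x_i - t H_i multiplies the value by x_i. -/
theorem inversionSeries_X_mul (H : σ → MvPolynomial σ ℂ) (i : σ) (a : MvPolynomial σ ℂ) :
    inversionSeries H (X i * a) =
      PowerSeries.C (X i) * inversionSeries H a + PowerSeries.X * inversionSeries H (H i * a) := by
  ext1 m
  rw [map_add, PowerSeries.coeff_C_mul, coeff_inversionSeries, coeff_inversionSeries,
    map_mul (rename Sum.inl), rename_X, mul_assoc, imageEval_X_inl_mul, pderiv_mul,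
    pderiv_inr_rename_inl, zero_mul, zero_add,
    pderiv_pow, pderiv_inr_xiDot, smul_add, mul_smul_comm]
  congr 1
  cases m with
  | zero => simp
  | succ m =>
    rw [PowerSeries.coeff_succ_X_mul, coeff_inversionSeries, Nat.add_sub_cancel,
      map_mul (rename Sum.inl)]
    have : rename Sum.inl a * (((m + 1 : ℕ) : MvPolynomial (σ ⊕ σ) ℂ) * xiDot H ^ m *
        rename Sum.inl (H i)) = ((m + 1 : ℕ) : ℂ) • (rename Sum.inl (H i) * rename Sum.inl a *
          xiDot H ^ m) := by
      rw [smul_eq_C_mul, map_natCast]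
      ring
    rw [this, map_smul, smul_smul]
    congr 1
    rw [Nat.factorial_succ]
    have h1 : ((m + 1 : ℕ) : ℂ) ≠ 0 := by exact_mod_cast m.succ_ne_zero
    have h2 : (m.factorial : ℂ) ≠ 0 := by exact_mod_cast m.factorial_ne_zero
    push_cast at h1 ⊢
    field_simp

theorem coeff_zero_inversionSeries (H : σ → MvPolynomial σ ℂ) (a : MvPolynomial σ ℂ) :
    PowerSeries.coeff 0 (inversionSeries H a) = a := by
  simp [coeff_inversionSeries, imageEval_rename_inl]

/-- The extension of `inversionSeries` to `ℂ[x][t]` which is linear over `ℂ[t]`. -/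
noncomputable def inversionSeriesExt (H : σ → MvPolynomial σ ℂ) :
    Polynomial (MvPolynomial σ ℂ) →ₗ[ℂ] PowerSeries (MvPolynomial σ ℂ) :=
  Polynomial.lsum fun j => LinearMap.mulLeft ℂ (PowerSeries.X ^ j) ∘ₗ inversionSeries H

theorem inversionSeriesExt_monomial (H : σ → MvPolynomial σ ℂ) (j : ℕ) (a : MvPolynomial σ ℂ) :
    inversionSeriesExt H (Polynomial.monomial j a) = PowerSeries.X ^ j * inversionSeries H a := by
  simp [inversionSeriesExt, Polynomial.lsum_apply, Polynomial.sum_monomial_index]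

theorem inversionSeriesExt_C (H : σ → MvPolynomial σ ℂ) (a : MvPolynomial σ ℂ) :
    inversionSeriesExt H (Polynomial.C a) = inversionSeries H a := by
  rw [← Polynomial.monomial_zero_left, inversionSeriesExt_monomial, pow_zero, one_mul]

theorem inversionSeriesExt_X_mul (H : σ → MvPolynomial σ ℂ)
    (P : Polynomial (MvPolynomial σ ℂ)) :
    inversionSeriesExt H (Polynomial.X * P) = PowerSeries.X * inversionSeriesExt H P := by
  induction P using Polynomial.induction_on' with
  | add p q hp hq => simp only [mul_add, map_add, hp, hq]
  | monomial n a =>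
    rw [Polynomial.X_mul_monomial, inversionSeriesExt_monomial, inversionSeriesExt_monomial,
      pow_succ', mul_assoc]

/-- At t = 0 the map is the identity on coefficients, so the lowest nonzero coefficient in t
survives. -/
theorem inversionSeriesExt_injective (H : σ → MvPolynomial σ ℂ) :
    Function.Injective (inversionSeriesExt H) := by
  rw [injective_iff_map_eq_zero]
  intro P hP
  by_contra hne
  obtain ⟨n, Q, rfl, hQ⟩ : ∃ n, ∃ Q : Polynomial (MvPolynomial σ ℂ),
      P = Polynomial.X ^ n * Q ∧ Q.coeff 0 ≠ 0 := by
    obtain ⟨Q, hQ⟩ := Polynomial.X_pow_dvd_iff.2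
      (fun d (hd : d < P.natTrailingDegree) => Polynomial.coeff_eq_zero_of_lt_natTrailingDegree hd)
    refine ⟨_, Q, hQ, fun h0 => hne ?_⟩
    have h1 : P.trailingCoeff = 0 := by
      rw [Polynomial.trailingCoeff]
      nth_rw 1 [hQ]
      rw [← h0]
      simpa using Polynomial.coeff_X_pow_mul Q P.natTrailingDegree 0
    exact Polynomial.trailingCoeff_eq_zero.1 h1
  have h1 : ∀ k, inversionSeriesExt H (Polynomial.X ^ k * Q) =
      PowerSeries.X ^ k * inversionSeriesExt H Q := by
    intro k
    induction k with
    | zero => simp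
    | succ k ih => rw [pow_succ', mul_assoc, inversionSeriesExt_X_mul, ih, pow_succ', mul_assoc]
  rw [h1] at hP
  have h2 : inversionSeriesExt H Q = 0 :=
    (mul_eq_zero.1 hP).resolve_left (pow_ne_zero _ PowerSeries.X_ne_zero)
  have h3 : PowerSeries.coeff 0 (inversionSeriesExt H Q) = Q.coeff 0 := by
    rw [← Polynomial.X_mul_divX_add Q, map_add, map_add, inversionSeriesExt_X_mul,
      inversionSeriesExt_C, coeff_zero_inversionSeries]
    simp
  rw [h2] at h3
  exact hQ (by simpa using h3.symm)

/-- The comorphism `x i ↦ x i - t H i` of a one-parameter deformation of the identity. -/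
noncomputable def deformation (H : σ → MvPolynomial σ ℂ) :
    MvPolynomial σ ℂ →ₐ[ℂ] Polynomial (MvPolynomial σ ℂ) :=
  aeval fun i => Polynomial.C (X i) - Polynomial.X * Polynomial.C (H i)

/-- The extended map is semilinear: multiplication by the image of g under x ↦ x - tH becomes
multiplication by g itself. It is enough to check the generators x_i. -/
theorem inversionSeriesExt_deformation_mul (H : σ → MvPolynomial σ ℂ) (g : MvPolynomial σ ℂ)
    (P : Polynomial (MvPolynomial σ ℂ)) :
    inversionSeriesExt H (deformation H g * P) =
      PowerSeries.C g * inversionSeriesExt H P := by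
  have hX : ∀ i (P : Polynomial (MvPolynomial σ ℂ)),
      inversionSeriesExt H ((Polynomial.C (X i) - Polynomial.X * Polynomial.C (H i)) * P) =
        PowerSeries.C (X i) * inversionSeriesExt H P := by
    intro i P
    induction P using Polynomial.induction_on' with
    | add p q hp hq => simp only [mul_add, map_add, hp, hq]
    | monomial n a =>
      rw [sub_mul, map_sub, mul_assoc, inversionSeriesExt_X_mul, Polynomial.C_mul_monomial,
        Polynomial.C_mul_monomial, inversionSeriesExt_monomial, inversionSeriesExt_monomial,
        inversionSeriesExt_monomial, inversionSeries_X_mul]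
      ring
  induction g using MvPolynomial.induction_on generalizing P with
  | C a =>
    have h1 : deformation H (C a) * P = a • P := by
      rw [← algebraMap_eq, AlgHom.commutes, Algebra.smul_def]
    rw [h1, map_smul]
    ext1 m
    rw [PowerSeries.coeff_C_mul, PowerSeries.coeff_smul, smul_eq_C_mul]
  | add p q hp hq => rw [map_add, add_mul, map_add, hp, hq, map_add, add_mul]
  | mul_X p i hp =>
    rw [map_mul (deformation H), mul_assoc, hp, deformation, aeval_X, hX, map_mul, mul_assoc]

theorem surjective_aeval_X_sub [DecidableEq σ] (hσ : HasImageProperty σ)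
    {H : σ → MvPolynomial σ ℂ} (hN : ∀ k : ℕ, (polyJacobian H ^ (k + 1)).trace = 0) :
    Function.Surjective (aeval (R := ℂ) fun i => X i - H i :
      MvPolynomial σ ℂ → MvPolynomial σ ℂ) := by
  have hone : inversionSeries H 1 = 1 := by
    ext1 m
    rw [coeff_inversionSeries, PowerSeries.coeff_one]
    cases m with
    | zero => simpa using imageEval_rename_inl (1 : MvPolynomial σ ℂ)
    | succ m => simp [imageEval_xiDot_pow_succ_eq_zero hN]
  have hX : ∀ i, X i ∈ (aeval (R := ℂ) fun i => X i - H i :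
      MvPolynomial σ ℂ →ₐ[ℂ] MvPolynomial σ ℂ).range := by
    intro i
    -- The image property gives E(x_i f^m) = 0 for m ≥ M, so the series of x_i is a polynomial G in
    -- t.
    obtain ⟨M, hM⟩ := hσ _ (imageEval_xiDot_pow_succ_eq_zero hN) (rename Sum.inl (X i))
    set G : Polynomial (MvPolynomial σ ℂ) := PowerSeries.trunc M (inversionSeries H (X i)) with hG
    have hGs : (G : PowerSeries (MvPolynomial σ ℂ)) = inversionSeries H (X i) := by
      ext1 m
      rw [Polynomial.coeff_coe, hG, PowerSeries.coeff_trunc]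
      split_ifs with h
      · rfl
      · rw [coeff_inversionSeries, hM m (not_lt.1 h), smul_zero]
    -- Since the series of 1 is 1, semilinearity makes the extended map a left inverse of the
    -- deformation.
    have hinv : ∀ P : Polynomial (MvPolynomial σ ℂ),
        inversionSeriesExt H (P.eval₂ (deformation H : _ →+* _) Polynomial.X) = P := by
      intro P
      induction P using Polynomial.induction_on' with
      | add p q hp hq => rw [Polynomial.eval₂_add, map_add, hp, hq, Polynomial.coe_add]
      | monomial n a =>
        rw [Polynomial.eval₂_monomial, AlgHom.coe_toRingHom, inversionSeriesExt_deformation_mul,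
          ← Polynomial.monomial_one_right_eq_X_pow, inversionSeriesExt_monomial, hone,
          Polynomial.coe_monomial, mul_one, PowerSeries.X_pow_eq, ← PowerSeries.monomial_zero_eq_C,
          PowerSeries.monomial_mul_monomial, zero_add, mul_one]
    have h1 : G.eval₂ (deformation H : _ →+* _) Polynomial.X = Polynomial.C (X i) :=
      inversionSeriesExt_injective H (by rw [hinv, hGs, inversionSeriesExt_C])
    -- By injectivity the deformation sends G to x_i; setting t = 1 exhibits a preimage of x_i under
    -- x ↦ x - H.
    refine ⟨G.eval 1, ?_⟩
    have h2 : ∀ P : Polynomial (MvPolynomial σ ℂ),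
        (P.eval₂ (deformation H : _ →+* _) Polynomial.X).eval 1 =
          aeval (R := ℂ) (fun i => X i - H i) (P.eval 1) := by
      intro P
      have hc : (Polynomial.evalRingHom (1 : MvPolynomial σ ℂ)).comp
          (deformation H : _ →+* _) =
          (aeval (R := ℂ) fun i => X i - H i :
            MvPolynomial σ ℂ →ₐ[ℂ] MvPolynomial σ ℂ).toRingHom := by
        refine MvPolynomial.ringHom_ext (fun a => ?_) (fun i => ?_)
        · simp [deformation, ← algebraMap_eq]
        · simp [deformation]
      have := Polynomial.hom_eval₂ P (deformation H : _ →+* _)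
        (Polynomial.evalRingHom (1 : MvPolynomial σ ℂ)) Polynomial.X
      rw [hc] at this
      simp only [Polynomial.coe_evalRingHom, Polynomial.eval_X] at this
      rw [this]
      simp
    have h3 := h2 G
    rw [h1, Polynomial.eval_C] at h3
    exact h3.symm
  rw [← AlgHom.range_eq_top, eq_top_iff, ← adjoin_range_X, Algebra.adjoin_le_iff]
  rintro _ ⟨i, rfl⟩
  exact hX i

end Inversion

/-! ### Reduction of the products of M(1) to a polynomial ring. -/

namespace Heisenberg

open MvPolynomial

variable {ι : Type*}

/-- The quotient map of `M(1)` by the ideal generated by the variables `X (i, n)` with `n ≥ 2`. -/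
noncomputable def proj (ι : Type*) : Fock ι →ₐ[ℂ] MvPolynomial ι ℂ :=
  aeval fun q => if q.2 = 1 then X q.1 else 0

/-- The embedding of `ℂ[h_i]` into `M(1)` which sends `h_i` to `h_i(-1) 𝟏`. -/
noncomputable def lift (ι : Type*) : MvPolynomial ι ℂ →ₐ[ℂ] Fock ι :=
  rename fun i => (i, 1)

theorem proj_lift (g : MvPolynomial ι ℂ) : proj ι (lift ι g) = g := by
  rw [lift, proj, aeval_rename]
  simp [Function.comp_def]

theorem nthMode_Y_monomial (s : ι × ℕ+ →₀ ℕ) (p : ℤ) :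
    MZVertex.nthMode (Y ι) (monomial s 1) p = zCoeff (Finsupp.toMultiset s).toList (-p - 1) := by
  have h : (monomial s (1 : ℂ)) = basisMonomials (ι × ℕ+) ℂ s := by simp
  rw [MZVertex.nthMode, h, Y, Module.Basis.constr_basis, monomialField,
    VertexOperator.ncoeff_of_coeff]

theorem zCoeff_singleton (q : ι × ℕ+) (k : ℤ) :
    zCoeff [q] k = fieldCoeff q.2 (-k - q.2) • mode q.1 (-k - q.2) := by
  refine LinearMap.ext fun w => ?_
  have hset : modeTuples [q] k = {fun _ => -k - (q.2 : ℤ)} := by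
    ext m
    simp only [modeTuples, Set.mem_ofPred_eq, Set.mem_singleton_iff]
    constructor
    · intro h
      funext j
      have h' : -m 0 - (q.2 : ℤ) = k := by simpa using h
      have : j = 0 := Subsingleton.elim (α := Fin 1) _ _
      subst this
      omega
    · rintro rfl
      simp
  have hno : ∀ m : ℤ, normalOrder [(q.1, m)] = mode q.1 m := by
    intro m
    rcases lt_or_ge m 0 with h | h
    · simp [normalOrder, h, not_le.2 h]
    · simp [normalOrder, h, not_lt.2 h]
  show ∑ᶠ m ∈ modeTuples [q] k, fieldTerm [q] m w = _
  rw [hset, finsum_mem_singleton, fieldTerm]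
  simp [hno]

theorem nthMode_Y_X (q : ι × ℕ+) (p : ℤ) :
    MZVertex.nthMode (Y ι) (X q) p =
      fieldCoeff q.2 (p + 1 - q.2) • mode q.1 (p + 1 - q.2) := by
  rw [X, nthMode_Y_monomial, Finsupp.toMultiset_single, one_smul, Multiset.toList_singleton,
    zCoeff_singleton]
  congr 2 <;> ring_nf

theorem fieldCoeff_one (m : ℤ) : fieldCoeff 1 m = 1 := by
  rw [fieldCoeff, show PNat.natPred 1 = 0 from rfl, Ring.choose_zero_right, Int.cast_one]

theorem nthMode_Y_gen_one (i : ι) (w : Fock ι) :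
    MZVertex.nthMode (Y ι) (gen i) 1 w = pderiv (i, 1) w := by
  rw [gen, nthMode_Y_X]
  simp only [fieldCoeff_one, one_smul]
  show mode i 1 w = _
  simp [mode]
  rfl

theorem nthMode_Y_gen_neg_one (i : ι) (w : Fock ι) :
    MZVertex.nthMode (Y ι) (gen i) (-1) w = X (i, 1) * w := by
  rw [gen, nthMode_Y_X]
  simp only [fieldCoeff_one, one_smul]
  rfl

/-- The (-2)-nd mode of h(-n)𝟏 is n times multiplication by h(-n-1), and n ≠ 0. -/
theorem X_succ_mul_mem_cTwo (i : ι) (n : ℕ+) (w : Fock ι) :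
    X (i, n + 1) * w ∈ MZVertex.cTwo (Y ι) := by
  have h : MZVertex.nthMode (Y ι) (X (i, n)) (-2) w = (n : ℂ) • (X (i, n + 1) * w) := by
    rw [nthMode_Y_X]
    obtain ⟨k, rfl⟩ : ∃ k : ℕ, n = k.succPNat := ⟨n.natPred, (PNat.succPNat_natPred n).symm⟩
    have hm : (-2 + 1 - ((k.succPNat : ℕ+) : ℤ) : ℤ) = Int.negSucc (k + 1) := by
      simp [Int.negSucc_eq]; ring
    have hc : fieldCoeff k.succPNat (Int.negSucc (k + 1)) = ((k.succPNat : ℕ) : ℂ) := by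
      have : (-Int.negSucc (k + 1) - 1 : ℤ) = ((k + 1 : ℕ) : ℤ) := by
        rw [Int.neg_negSucc]; push_cast; ring
      rw [fieldCoeff, this, Ring.choose_natCast]
      simp
    simp only [hm, hc]
    rfl
  have hn : ((n : ℕ) : ℂ) ≠ 0 := by exact_mod_cast n.ne_zero
  have h2 : X (i, n + 1) * w = ((n : ℕ) : ℂ)⁻¹ • MZVertex.nthMode (Y ι) (X (i, n)) (-2) w := by
    rw [h, inv_smul_smul₀ hn]
  rw [h2]
  exact Submodule.smul_mem _ _ (Submodule.subset_span ⟨_, _, rfl⟩)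

theorem sub_lift_proj_mem_cTwo (w : Fock ι) :
    w - lift ι (proj ι w) ∈ MZVertex.cTwo (Y ι) := by
  -- The arbitrary multiplier v lets the induction pass through products.
  suffices h : ∀ v, (w - lift ι (proj ι w)) * v ∈ MZVertex.cTwo (Y ι) by simpa using h 1
  induction w using MvPolynomial.induction_on with
  | C a => intro v; simp [proj, lift]
  | add p q hp hq =>
    intro v
    have := add_mem (hp v) (hq v)
    rwa [← add_mul, sub_add_sub_comm, ← map_add, ← map_add] at this
  | mul_X p q hp =>
    intro v
    obtain ⟨i, n⟩ := q
    by_cases hn : n = 1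
    · have h1 : lift ι (proj ι (X (i, n))) = X (i, n) := by simp [proj, lift, hn]
      rw [map_mul, map_mul, h1, ← sub_mul, mul_assoc]
      exact hp _
    · have h1 : proj ι (X (i, n)) = 0 := by simp [proj, hn]
      rw [map_mul, h1, mul_zero, map_zero, sub_zero, mul_comm p, mul_assoc]
      obtain ⟨k, rfl⟩ := PNat.exists_eq_succ_of_ne_one hn
      exact X_succ_mul_mem_cTwo i k _

theorem mode_negSucc (i : ι) (k : ℕ) (v : Fock ι) :
    mode i (Int.negSucc k) v = X (i, k.succPNat) * v := rfl

theorem proj_mode_of_neg (i : ι) {m : ℤ} (hm : m < 0) (v : Fock ι) :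
    proj ι (mode i m v) = (if m = -1 then X i else 0) * proj ι v := by
  obtain ⟨k, rfl⟩ := Int.eq_negSucc_of_lt_zero hm
  have h : (k.succPNat = 1) ↔ (Int.negSucc k = -1) := by
    rw [← PNat.coe_inj, Nat.succPNat_coe, PNat.one_coe, Int.negSucc_eq]
    omega
  rw [mode_negSucc, map_mul, proj, aeval_X]
  by_cases hk : k.succPNat = 1
  · rw [if_pos hk, if_pos (h.1 hk)]
  · rw [if_neg hk, if_neg fun h' => hk (h.2 h')]

theorem proj_prod_mode_of_neg (L : List (ι × ℤ)) (hL : ∀ a ∈ L, a.2 < 0) (v : Fock ι) :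
    proj ι ((L.map fun a => mode a.1 a.2).prod v) =
      (L.map fun a => if a.2 = -1 then X a.1 else 0).prod * proj ι v := by
  induction L with
  | nil => simp
  | cons a L ih =>
    simp only [List.map_cons, List.prod_cons, Module.End.mul_apply]
    rw [proj_mode_of_neg _ (hL a (by simp)), ih fun b hb => hL b (by simp [hb]), mul_assoc]

/-- Modes h(m) with m ≤ -2 multiply by a variable that `proj` kills, and h(0) = 0. If m = -1, the
binomial coefficient vanishes unless n = 1. -/
theorem of_proj_fieldTerm_ne_zero {l : List (ι × ℕ+)} {m : Fin l.length → ℤ} {w : Fock ι}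
    (h : proj ι (fieldTerm l m w) ≠ 0) (j : Fin l.length) :
    (m j = -1 ∧ (l.get j).2 = 1) ∨ 0 < m j := by
  have hne : fieldTerm l m w ≠ 0 := fun h0 => h (by rw [h0, map_zero])
  obtain ⟨N, hN⟩ := exists_bound w
  have h1 := (fieldTerm_ne_zero hN hne j).2
  rw [fieldTerm, LinearMap.smul_apply, map_smul] at h
  have h2 := (smul_ne_zero_iff.1 h).2
  have hmem : ((l.get j).1, m j) ∈ List.ofFn fun j => ((l.get j).1, m j) := by
    rw [List.mem_ofFn]; exact ⟨j, rfl⟩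
  rw [normalOrder, List.map_append, List.prod_append, Module.End.mul_apply,
    proj_prod_mode_of_neg _ (by simp)] at h2
  rcases lt_trichotomy (m j) 0 with hj | hj | hj
  · left
    have hm1 : m j = -1 := by
      by_contra hm1
      refine (mul_ne_zero_iff.1 h2).1 (List.prod_eq_zero ?_)
      rw [List.mem_map]
      exact ⟨((l.get j).1, m j), List.mem_filter.2 ⟨hmem, by simpa using hj⟩, by simp [hm1]⟩
    refine ⟨hm1, ?_⟩
    have h3 := h1 hj
    have h4 := (l.get j).2.pos
    rw [← PNat.coe_inj, PNat.one_coe]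
    omega
  · exfalso
    refine (mul_ne_zero_iff.1 h2).2 ?_
    have h3 : (((List.ofFn fun j => ((l.get j).1, m j)).filter fun a => 0 ≤ a.2).map
        fun a => mode a.1 a.2).prod = 0 := by
      refine List.prod_eq_zero ?_
      rw [List.mem_map]
      refine ⟨((l.get j).1, m j), List.mem_filter.2 ⟨hmem, by simp [hj]⟩, ?_⟩
      rw [hj]
      rfl
    rw [h3, LinearMap.zero_apply, map_zero]
  · exact Or.inr hj

/-- A factor contributes the exponent -m - n of z: this is 0 when m = -1 and n = 1, and at most -2
when m > 0. A total of at least -1 leaves no room for a positive mode. -/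
theorem of_proj_fieldTerm_ne_zero_of_mem {l : List (ι × ℕ+)} {m : Fin l.length → ℤ} {w : Fock ι}
    {k : ℤ} (hk : -1 ≤ k) (hm : m ∈ modeTuples l k) (h : proj ι (fieldTerm l m w) ≠ 0) :
    k = 0 ∧ (m = fun _ => -1) ∧ ∀ j, (l.get j).2 = 1 := by
  have hj := of_proj_fieldTerm_ne_zero h
  have hle : ∀ j, -m j - ((l.get j).2 : ℤ) ≤ 0 := by
    intro j
    have := (l.get j).2.pos
    rcases hj j with ⟨h1, h2⟩ | h1
    · rw [h1, h2]; simp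
    · omega
  have hall : ∀ j, m j = -1 ∧ (l.get j).2 = 1 := by
    intro j
    refine (hj j).resolve_right fun hpos => ?_
    have h2 : ∑ j, (-m j - ((l.get j).2 : ℤ)) = k := hm
    rw [← Finset.add_sum_erase _ _ (Finset.mem_univ j)] at h2
    have h1 := Finset.sum_nonpos fun i (_ : i ∈ Finset.univ.erase j) => hle i
    have := (l.get j).2.pos
    omega
  refine ⟨?_, funext fun j => (hall j).1, fun j => (hall j).2⟩
  rw [← show ∑ j, (-m j - ((l.get j).2 : ℤ)) = k from hm]
  refine Finset.sum_eq_zero fun j _ => ?_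
  rw [(hall j).1, (hall j).2]
  simp

theorem proj_zCoeff (l : List (ι × ℕ+)) (k : ℤ) (w : Fock ι) :
    proj ι (zCoeff l k w) = ∑ᶠ m ∈ modeTuples l k, proj ι (fieldTerm l m w) :=
  (proj ι).toLinearMap.toAddMonoidHom.map_finsum_mem' (finite_support l k w)

theorem proj_zCoeff_eq_zero (l : List (ι × ℕ+)) {k : ℤ} (hk : -1 ≤ k) (hk0 : k ≠ 0)
    (w : Fock ι) : proj ι (zCoeff l k w) = 0 := by
  rw [proj_zCoeff]
  refine finsum_mem_eq_zero_of_forall_eq_zero fun m hm => ?_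
  by_contra h
  exact hk0 (of_proj_fieldTerm_ne_zero_of_mem hk hm h).1

theorem proj_zCoeff_zero (l : List (ι × ℕ+)) (w : Fock ι) :
    proj ι (zCoeff l 0 w) = proj ι (l.map X).prod * proj ι w := by
  classical
  rw [proj_zCoeff, map_list_prod, List.map_map]
  by_cases hl : ∀ j, (l.get j).2 = 1
  · have h0 : (fun _ => -1) ∈ modeTuples l 0 := by
      show ∑ j, (-(-1) - ((l.get j).2 : ℤ)) = 0
      exact Finset.sum_eq_zero fun j _ => by rw [hl]; simp
    rw [finsum_eq_single _ (fun _ => -1)]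
    · rw [finsum_eq_if, if_pos h0, fieldTerm, normalOrder]
      have hf1 : (List.ofFn fun j => ((l.get j).1, (-1 : ℤ))).filter (fun a => a.2 < 0) =
          List.ofFn fun j => ((l.get j).1, (-1 : ℤ)) := by
        rw [List.filter_eq_self]
        intro a ha
        obtain ⟨j, rfl⟩ := (List.mem_ofFn' _ _).1 ha
        simp
      have hf2 : (List.ofFn fun j => ((l.get j).1, (-1 : ℤ))).filter (fun a => 0 ≤ a.2) = [] := by
        rw [List.filter_eq_nil_iff]
        intro a ha
        obtain ⟨j, rfl⟩ := (List.mem_ofFn' _ _).1 ha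
        simp
      have hc : ∏ j, fieldCoeff (l.get j).2 (-1) = 1 :=
        Finset.prod_eq_one fun j _ => by rw [hl, fieldCoeff_one]
      rw [hf1, hf2, hc, one_smul, List.append_nil, proj_prod_mode_of_neg]
      · congr 2
        rw [List.map_ofFn]
        conv_rhs => rw [← List.ofFn_get l, List.map_ofFn]
        congr 1
        funext j
        have := hl j
        simp only [List.get_eq_getElem] at this
        simp [proj, this]
      · intro a ha
        obtain ⟨j, rfl⟩ := (List.mem_ofFn' _ _).1 ha
        simp
    · intro m hm
      rw [finsum_eq_if]
      split_ifs with h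
      · by_contra hne
        exact hm (of_proj_fieldTerm_ne_zero_of_mem (by norm_num) h hne).2.1
      · rfl
  · rw [finsum_mem_eq_zero_of_forall_eq_zero fun m hm => ?_]
    · push Not at hl
      obtain ⟨j, hj⟩ := hl
      rw [List.prod_eq_zero, zero_mul]
      rw [List.mem_map]
      refine ⟨l.get j, List.get_mem _ _, ?_⟩
      simp only [List.get_eq_getElem] at hj
      simp [proj, hj]
    · by_contra hne
      exact hl (of_proj_fieldTerm_ne_zero_of_mem (by norm_num) hm hne).2.2

theorem prod_map_X_toList (s : ι × ℕ+ →₀ ℕ) :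
    ((Finsupp.toMultiset s).toList.map (X (R := ℂ))).prod = monomial s 1 := by
  rw [← Multiset.prod_coe, ← Multiset.map_coe, Multiset.coe_toList]
  induction s using Finsupp.induction_linear with
  | zero => simp
  | add s t hs ht =>
    rw [map_add, Multiset.map_add, Multiset.prod_add, hs, ht, monomial_mul, one_mul]
  | single q n =>
    rw [Finsupp.toMultiset_single, Multiset.map_nsmul, Multiset.prod_nsmul, Multiset.map_singleton,
      Multiset.prod_singleton, X_pow_eq_monomial]

/-- The p-th product is the coefficient of z^(-p-1). The case p = 0 handles the 0-th products in the
radicals, and p = -2 handles C₂. -/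
theorem proj_nthMode_eq_zero {p : ℤ} (hp : p ≤ 0) (hp' : p ≠ -1) (u w : Fock ι) :
    proj ι (MZVertex.nthMode (Y ι) u p w) = 0 := by
  induction u using MvPolynomial.induction_on' with
  | monomial s a =>
    rw [show monomial s a = a • monomial s (1 : ℂ) by simp [smul_monomial], MZVertex.nthMode,
      map_smul, map_smul, Pi.smul_apply, LinearMap.smul_apply, map_smul]
    have := proj_zCoeff_eq_zero (Finsupp.toMultiset s).toList (k := -p - 1) (by omega) (by omega) w
    rw [← nthMode_Y_monomial, MZVertex.nthMode] at this
    rw [this, smul_zero]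
  | add u v hu hv =>
    rw [MZVertex.nthMode] at hu hv ⊢
    rw [map_add, map_add, Pi.add_apply, LinearMap.add_apply, map_add, hu, hv, add_zero]

theorem proj_nthMode_neg_one (u w : Fock ι) :
    proj ι (MZVertex.nthMode (Y ι) u (-1) w) = proj ι u * proj ι w := by
  induction u using MvPolynomial.induction_on' with
  | monomial s a =>
    rw [show monomial s a = a • monomial s (1 : ℂ) by simp [smul_monomial], MZVertex.nthMode,
      map_smul, map_smul, Pi.smul_apply, LinearMap.smul_apply, map_smul, map_smul, smul_mul_assoc]
    have := proj_zCoeff_zero (Finsupp.toMultiset s).toList w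
    rw [prod_map_X_toList, show (0 : ℤ) = -(-1) - 1 by norm_num, ← nthMode_Y_monomial,
      MZVertex.nthMode] at this
    rw [this]
  | add u v hu hv =>
    rw [MZVertex.nthMode] at hu hv ⊢
    rw [map_add, map_add, Pi.add_apply, LinearMap.add_apply, map_add, hu, hv, map_add, add_mul]

/-! ### From the MZ condition to the image property. -/

section ImageSubspace

variable {n : ℕ}

theorem proj_pderiv (i : ι) (w : Fock ι) : proj ι (pderiv (i, 1) w) = pderiv i (proj ι w) := by
  classical
  induction w using MvPolynomial.induction_on with
  | C a => simp [proj]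
  | add p q hp hq => simp only [map_add, hp, hq]
  | mul_X p q hp =>
    obtain ⟨j, k⟩ := q
    have h : proj ι (pderiv (i, 1) (X (j, k))) = pderiv i (proj ι (X (j, k))) := by
      by_cases hk : k = 1
      · by_cases hj : j = i
        · subst hj; simp [proj, hk]
        · rw [pderiv_X_of_ne (by simp [hj])]
          simp [proj, hk, pderiv_X_of_ne hj]
      · rw [pderiv_X_of_ne (by simp [hk])]
        simp [proj, hk]
    simp only [pderiv_mul, map_add, map_mul, hp, h]

theorem fMap_apply (i : Fin n) (w : Fock (Fin n ⊕ Fin n)) :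
    fMap i w = pderiv (Sum.inl i, 1) w - X (Sum.inr i, 1) * w := by
  rw [fMap, LinearMap.sub_apply, nthMode_Y_gen_one, nthMode_Y_gen_neg_one]

theorem proj_fMap (i : Fin n) (w : Fock (Fin n ⊕ Fin n)) :
    proj _ (fMap i w) = imageOp i (proj _ w) := by
  rw [fMap_apply, map_sub, map_mul, proj_pderiv, imageOp_apply]
  congr 2
  simp [proj]

theorem fMap_lift (i : Fin n) (g : MvPolynomial (Fin n ⊕ Fin n) ℂ) :
    fMap i (lift _ g) = lift _ (imageOp i g) := by
  have hinj : Function.Injective fun j : Fin n ⊕ Fin n => (j, (1 : ℕ+)) :=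
    fun a b h => congrArg Prod.fst h
  rw [fMap_apply, imageOp_apply, map_sub, map_mul]
  congr 1
  · exact pderiv_rename hinj _ _
  · simp [lift]

/-- `proj` carries f_i to ∂/∂x_i - ξ_i and kills C₂, while its kernel lies in C₂; so membership is
decided by E after projection. -/
theorem mem_imageSubspace_iff (w : Fock (Fin n ⊕ Fin n)) :
    w ∈ imageSubspace n ↔ imageEval (Fin n) (proj _ w) = 0 := by
  constructor
  · intro hw
    have hle : imageSubspace n ≤
        LinearMap.ker (imageEval (Fin n) ∘ₗ (proj (Fin n ⊕ Fin n)).toLinearMap) := by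
      refine sup_le (iSup_le fun i => ?_) (Submodule.span_le.2 ?_)
      · rintro _ ⟨v, rfl⟩
        rw [LinearMap.mem_ker, LinearMap.comp_apply, AlgHom.toLinearMap_apply, proj_fMap,
          imageEval_imageOp]
      · rintro _ ⟨u, v, rfl⟩
        rw [SetLike.mem_coe, LinearMap.mem_ker, LinearMap.comp_apply, AlgHom.toLinearMap_apply,
          proj_nthMode_eq_zero (by norm_num) (by norm_num), map_zero]
    exact hle hw
  · intro hw
    rw [imageEval_eq_zero_iff] at hw
    have hle : (⨆ i : Fin n, LinearMap.range (imageOp i)) ≤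
        (⨆ i : Fin n, LinearMap.range (fMap i)).comap (lift (Fin n ⊕ Fin n)).toLinearMap := by
      refine iSup_le fun i => ?_
      rintro _ ⟨g, rfl⟩
      exact Submodule.mem_iSup_of_mem i ⟨lift _ g, fMap_lift i g⟩
    have h1 : lift _ (proj _ w) ∈ imageSubspace n := Submodule.mem_sup_left (hle hw)
    have h2 : w - lift _ (proj _ w) ∈ imageSubspace n :=
      Submodule.mem_sup_right (sub_lift_proj_mem_cTwo w)
    simpa using add_mem h2 h1

theorem proj_iterProd_replicate (v : Fock ι) (t : ℕ) :
    proj ι (MZVertex.iterProd (Y ι) v (List.replicate t (-1))) = proj ι v ^ (t + 1) := by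
  induction t with
  | zero => simp [MZVertex.iterProd]
  | succ t ih =>
    rw [List.replicate_succ, MZVertex.iterProd, List.foldr_cons, proj_nthMode_neg_one,
      pow_succ' _ (t + 1), ← ih, MZVertex.iterProd]

/-- A single 0-th product kills the projection. With only (-1)-st products, t modes applied to v
give the power t + 1. -/
theorem proj_iterProd (v : Fock ι) (L : List ℤ) (hL : MZVertex.IsZeroNegOne L) :
    proj ι (MZVertex.iterProd (Y ι) v L) = 0 ∨
      proj ι (MZVertex.iterProd (Y ι) v L) = proj ι v ^ (L.length + 1) := by
  induction L with
  | nil => simp [MZVertex.iterProd]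
  | cons p L ih =>
    rw [MZVertex.iterProd, List.foldr_cons]
    rcases hL p (by simp) with rfl | rfl
    · exact Or.inl (proj_nthMode_eq_zero le_rfl (by norm_num) _ _)
    · rw [proj_nthMode_neg_one]
      rcases ih fun q hq => hL q (by simp [hq]) with h | h <;> rw [MZVertex.iterProd] at h
      · exact Or.inl (by rw [h, mul_zero])
      · exact Or.inr (by rw [h, List.length_cons, pow_succ' _ (L.length + 1)])

theorem hasImageProperty_of_isMZSubspace
    (h : MZVertex.IsMZSubspace (Y (Fin n ⊕ Fin n)) (imageSubspace n)) :
    HasImageProperty (Fin n) := by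
  intro P hP g
  have hrad : lift _ P ∈ MZVertex.radical (Y (Fin n ⊕ Fin n)) (imageSubspace n) := by
    refine ⟨0, fun L hL _ => ?_⟩
    rw [mem_imageSubspace_iff]
    rcases proj_iterProd (lift _ P) L hL with h | h
    · rw [h, map_zero]
    · rw [h, proj_lift, hP]
  rw [h] at hrad
  -- Only the left-strong radical is needed, with b = g, s = -1 and lists consisting of -1.
  obtain ⟨m, hm⟩ := hrad.1 (lift _ g)
  refine ⟨m + 1, fun t ht => ?_⟩
  obtain ⟨t, rfl⟩ : ∃ k, t = k + 1 := ⟨t - 1, by omega⟩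
  have := hm (List.replicate t (-1)) (fun p hp => Or.inr (List.eq_of_mem_replicate hp))
    (by simp; omega) (-1) (Or.inr rfl)
  rwa [mem_imageSubspace_iff, proj_nthMode_neg_one, proj_iterProd_replicate, proj_lift,
    proj_lift] at this

end ImageSubspace

end Heisenberg

/-! ### Block companion matrices and nilpotency. -/

section Companion

variable {σ A : Type*} [Fintype σ] [DecidableEq σ] [CommRing A] {d : ℕ}

/-- The block companion matrix with first block column `b 0, …, b d` and identity blocks above the
diagonal. -/
def blockCompanion (b : Fin (d + 1) → Matrix σ σ A) :
    Matrix (σ × Fin (d + 1)) (σ × Fin (d + 1)) A :=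
  Matrix.of fun p q => (if q.2 = 0 then b p.2 p.1 q.1 else 0) +
    if p.1 = q.1 ∧ (q.2 : ℕ) = p.2 + 1 then 1 else 0

-- With S the shift and B the first block column, both scaled by t, 1 - tM = (1 - S) - BE. Here 1 -
-- S is unipotent, and the identity det(1 - UV) = det(1 - VU) shrinks the determinant to the size of
-- one block.
open Polynomial in
theorem charpolyRev_blockCompanion (b : Fin (d + 1) → Matrix σ σ A) :
    (blockCompanion b).charpolyRev =
      (1 - ∑ k : Fin (d + 1), (X : A[X]) ^ ((k : ℕ) + 1) • (b k).map C).det := by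
  set S : Matrix (σ × Fin (d + 1)) (σ × Fin (d + 1)) A[X] :=
    Matrix.of fun p q => if p.1 = q.1 ∧ (q.2 : ℕ) = p.2 + 1 then X else 0 with hS
  set B : Matrix (σ × Fin (d + 1)) σ A[X] := Matrix.of fun p j => X * C (b p.2 p.1 j) with hB
  set E : Matrix σ (σ × Fin (d + 1)) A[X] :=
    Matrix.of fun i q => if i = q.1 ∧ q.2 = 0 then 1 else 0 with hE
  set V : Matrix σ (σ × Fin (d + 1)) A[X] :=
    Matrix.of fun i q => if i = q.1 then X ^ (q.2 : ℕ) else 0 with hV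
  have h1 : 1 - (X : A[X]) • (blockCompanion b).map C = (1 - S) - B * E := by
    ext1 p q
    obtain ⟨i, k⟩ := p
    obtain ⟨j, l⟩ := q
    have hBE : (B * E) (i, k) (j, l) = if l = 0 then X * C (b k i j) else 0 := by
      rw [Matrix.mul_apply]
      by_cases hl : l = 0 <;> simp [hB, hE, hl]
    rw [Matrix.sub_apply, Matrix.sub_apply, Matrix.sub_apply, hBE]
    simp only [blockCompanion, hS, Matrix.smul_apply, Matrix.map_apply, Matrix.of_apply, smul_eq_mul]
    split_ifs <;> simp <;> ring
  have hdet : (1 - S).det = 1 := by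
    have hbt : Matrix.BlockTriangular (1 - S) (fun p : σ × Fin (d + 1) => p.2) := by
      intro p q hpq
      have h2 : p ≠ q := by rintro rfl; exact lt_irrefl _ hpq
      have h3 : ¬ (q.2 : ℕ) = p.2 + 1 := by
        have : (q.2 : ℕ) < p.2 := hpq
        omega
      simp [hS, h2, h3]
    rw [hbt.det_fintype]
    refine Finset.prod_eq_one fun k _ => ?_
    have : (1 - S).toSquareBlock (fun p : σ × Fin (d + 1) => p.2) k = 1 := by
      ext1 p q
      have h3 : ¬ ((q : σ × Fin (d + 1)).2 : ℕ) = (p : σ × Fin (d + 1)).2 + 1 := by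
        rw [p.2, q.2]; omega
      simp [Matrix.toSquareBlock, Matrix.toSquareBlockProp, hS, Matrix.one_apply, h3,
        Subtype.ext_iff]
    rw [this, Matrix.det_one]
  -- V is the geometric series ∑ E S^k, whose blocks are the powers of t.
  have hVS : V * (1 - S) = E := by
    ext1 i q
    obtain ⟨j, l⟩ := q
    rw [Matrix.mul_sub, Matrix.mul_one, Matrix.sub_apply, Matrix.mul_apply, Fintype.sum_prod_type]
    simp only [hV, hS, hE, Matrix.of_apply]
    rw [Finset.sum_eq_single i (by intro k _ hk; simp [hk.symm]) (by simp)]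
    by_cases hij : i = j
    · subst hij
      cases l using Fin.cases with
      | zero => simp
      | succ l =>
        rw [Finset.sum_eq_single l.castSucc]
        · simp [pow_succ]
        · intro m _ hm
          have : ¬ ((l.succ : Fin (d + 1)) : ℕ) = m + 1 := by
            intro h
            apply hm
            ext
            simp at h ⊢
            omega
          rw [if_neg (fun h : i = i ∧ _ => this h.2), mul_zero]
        · simp
    · simp [hij]
  have hu : IsUnit (1 - S).det := by rw [hdet]; exact isUnit_one
  have hE' : E * (1 - S)⁻¹ = V := by
    rw [← hVS, Matrix.mul_nonsing_inv_cancel_right _ _ hu]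
  have h4 : (1 - S) - B * E = (1 - S) * (1 - (1 - S)⁻¹ * B * E) := by
    rw [Matrix.mul_sub, Matrix.mul_one, Matrix.mul_assoc, ← Matrix.mul_assoc (1 - S),
      Matrix.mul_nonsing_inv _ hu, Matrix.one_mul]
  rw [Matrix.charpolyRev, h1, h4, Matrix.det_mul, hdet, one_mul,
    Matrix.det_one_sub_mul_comm, ← Matrix.mul_assoc, hE']
  congr 2
  ext1 i j
  rw [Matrix.mul_apply, Fintype.sum_prod_type, Matrix.sum_apply,
    Finset.sum_eq_single i (by intro k _ hk; simp [hV, hk.symm]) (by simp)]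
  refine Finset.sum_congr rfl fun k _ => ?_
  simp only [hV, hB, Matrix.of_apply, if_true, Matrix.smul_apply, Matrix.map_apply, smul_eq_mul]
  ring

/-- Reversing coefficients makes the characteristic polynomial a pure power of X; Cayley–Hamilton
concludes. -/
theorem Matrix.isNilpotent_of_charpolyRev_eq_one [Nontrivial A] {N : Matrix σ σ A}
    (h : N.charpolyRev = 1) : IsNilpotent N := by
  have hc : N.charpoly = Polynomial.X ^ Fintype.card σ := by
    rw [← Matrix.reverse_charpoly] at h
    ext k
    rw [Polynomial.coeff_X_pow]
    rcases le_or_gt k (Fintype.card σ) with hk | hk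
    · have h1 := congrArg (fun p => p.coeff (Fintype.card σ - k)) h
      simp only [Polynomial.coeff_reverse, Matrix.charpoly_natDegree_eq_dim] at h1
      rw [Polynomial.revAt_le (by omega), Nat.sub_sub_self hk, Polynomial.coeff_one] at h1
      rw [h1]
      congr 1
      simp only [eq_iff_iff]
      omega
    · rw [if_neg hk.ne', Polynomial.coeff_eq_zero_of_natDegree_lt
        (by rwa [Matrix.charpoly_natDegree_eq_dim])]
  refine ⟨Fintype.card σ, ?_⟩
  have := Matrix.aeval_self_charpoly N
  rwa [hc, map_pow, Polynomial.aeval_X] at this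

theorem Matrix.trace_pow_succ_eq_zero_of_charpolyRev_eq_one [IsDomain A] {N : Matrix σ σ A}
    (h : N.charpolyRev = 1) (k : ℕ) : (N ^ (k + 1)).trace = 0 :=
  (Matrix.isNilpotent_trace_of_isNilpotent
    ((Matrix.isNilpotent_of_charpolyRev_eq_one h).pow_succ k)).eq_zero

end Companion

/-! ### Reduction to a nilpotent Jacobian by adding variables. -/

section Reduction

open MvPolynomial

variable {σ : Type*} {d : ℕ}

/-- The map `(x_0, …, x_d) ↦ (K_k(x_0) + x_{k+1})_k`, where `x_{d+1} = 0`. -/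
noncomputable def companionMap (K : σ → Fin (d + 1) → MvPolynomial σ ℂ) (p : σ × Fin (d + 1)) :
    MvPolynomial (σ × Fin (d + 1)) ℂ :=
  rename (fun j => (j, 0)) (K p.1 p.2) +
    if h : (p.2 : ℕ) + 1 < d + 1 then X (p.1, ⟨p.2 + 1, h⟩) else 0

theorem polyJacobian_companionMap [DecidableEq σ] [Fintype σ]
    (K : σ → Fin (d + 1) → MvPolynomial σ ℂ) :
    polyJacobian (companionMap K) = blockCompanion fun k =>
      (polyJacobian fun i => K i k).map (rename fun j => (j, (0 : Fin (d + 1)))) := by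
  ext1 p q
  obtain ⟨i, k⟩ := p
  obtain ⟨j, l⟩ := q
  simp only [polyJacobian, companionMap, blockCompanion, Matrix.of_apply, map_add, Matrix.map_apply]
  congr 1
  · split_ifs with hl
    · subst hl
      exact pderiv_rename (fun a b h => congrArg Prod.fst h) _ _
    · apply pderiv_eq_zero_of_notMem_vars
      intro h
      have := vars_rename _ _ h
      simp only [Finset.mem_image, Prod.mk.injEq] at this
      obtain ⟨_, _, _, h0⟩ := this
      exact hl h0.symm
  · by_cases h : (k : ℕ) + 1 < d + 1
    · rw [dif_pos h, pderiv_X, Pi.single_apply]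
      congr 1
      simp [Prod.ext_iff, Fin.ext_iff, eq_comm]
    · rw [dif_neg h, map_zero, if_neg]
      rintro ⟨_, h2⟩
      exact h (h2 ▸ l.2)

theorem aeval_X_mul_of_isHomogeneous {σ τ : Type*} (f : σ → τ) {p : MvPolynomial σ ℂ} {m : ℕ}
    (hp : p.IsHomogeneous m) :
    aeval (fun i => (Polynomial.X * Polynomial.C (X (f i)) : Polynomial (MvPolynomial τ ℂ))) p =
      Polynomial.X ^ m * Polynomial.C (rename f p) := by
  rw [p.as_sum, map_sum, map_sum, map_sum, Finset.mul_sum]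
  refine Finset.sum_congr rfl fun s hs => ?_
  have hdeg : s.degree = m := by
    have := hp (mem_support_iff.1 hs)
    rwa [Finsupp.degree_eq_weight_one]
  have hX : s.prod (fun _ k => (Polynomial.X : Polynomial (MvPolynomial τ ℂ)) ^ k) =
      Polynomial.X ^ m := by
    rw [← hdeg, Finsupp.prod, Finset.prod_pow_eq_pow_sum, Finsupp.degree]
    rfl
  rw [rename_eq_aeval, aeval_monomial, aeval_monomial, map_mul, map_finsuppProd]
  simp only [mul_pow, Finsupp.prod_mul, hX, map_pow, Function.comp_apply]
  rw [mul_left_comm]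
  rfl

/-- The enlarged map has Jacobian M with det(1 - tM) = det(1 - ∑ t^(k+1) JK_k(x_0)). As JK_k is
homogeneous of degree k + 1, this is det(1 - JH) evaluated at t x_0, hence 1. Surjectivity for the
enlarged map then descends to x - H. -/
theorem surjective_of_det_one_sub_polyJacobian [Fintype σ] [DecidableEq σ]
    (hσ : ∀ d : ℕ, HasImageProperty (σ × Fin (d + 1)))
    {H : σ → MvPolynomial σ ℂ} {K : σ → Fin (d + 1) → MvPolynomial σ ℂ}
    (hK : ∀ i k, (K i k).IsHomogeneous (k + 2)) (hH : ∀ i, H i = ∑ k, K i k)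
    (hdet : (1 - polyJacobian H).det = 1) :
    Function.Surjective (aeval (R := ℂ) fun i => X i - H i :
      MvPolynomial σ ℂ → MvPolynomial σ ℂ) := by
  have hrev : (polyJacobian (companionMap K)).charpolyRev = 1 := by
    rw [polyJacobian_companionMap, charpolyRev_blockCompanion]
    set Θ : MvPolynomial σ ℂ →ₐ[ℂ] Polynomial (MvPolynomial (σ × Fin (d + 1)) ℂ) :=
      aeval fun i => Polynomial.X * Polynomial.C (X (i, 0)) with hΘ
    have h1 := congrArg Θ hdet
    rw [AlgHom.map_det, map_one, map_sub, map_one] at h1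
    rw [← h1]
    congr 2
    ext1 i j
    rw [Matrix.sum_apply, AlgHom.mapMatrix_apply, Matrix.map_apply, polyJacobian, Matrix.of_apply,
      hH, map_sum, map_sum]
    refine Finset.sum_congr rfl fun k _ => ?_
    rw [hΘ, aeval_X_mul_of_isHomogeneous (fun j => (j, (0 : Fin (d + 1)))) (hK i k).pderiv]
    rfl
  have hsurj := surjective_aeval_X_sub (hσ d)
    (Matrix.trace_pow_succ_eq_zero_of_charpolyRev_eq_one hrev)
  -- The tails T_k = K_k + ⋯ + K_d solve T_k = K_k + T_{k+1}.
  set T : σ → ℕ → MvPolynomial σ ℂ := fun j k => ∑ l : Fin (d + 1), if k ≤ l then K j l else 0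
    with hT
  have hT0 : ∀ j, T j 0 = H j := fun j => by simp [hT, hH]
  have hTend : ∀ j k, d + 1 ≤ k → T j k = 0 := fun j k hk =>
    Finset.sum_eq_zero fun l _ => if_neg (by omega)
  have hTs : ∀ j (k : Fin (d + 1)), T j k = K j k + T j (k + 1) := by
    intro j k
    have : ∀ l : Fin (d + 1), (if (k : ℕ) ≤ l then K j l else 0) =
        (if l = k then K j l else 0) + if (k : ℕ) + 1 ≤ l then K j l else 0 := by
      intro l
      rcases lt_trichotomy (l : ℕ) k with h | h | h
      · rw [if_neg (by omega), if_neg (by rintro rfl; omega), if_neg (by omega), add_zero]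
      · rw [if_pos (by omega), if_pos (Fin.ext h), if_neg (by omega), add_zero]
      · rw [if_pos (by omega), if_neg (by rintro rfl; omega), if_pos (by omega), zero_add]
    simp only [hT, this, Finset.sum_add_distrib]
    simp
  set F : MvPolynomial σ ℂ →ₐ[ℂ] MvPolynomial σ ℂ := aeval fun i => X i - H i with hF
  -- ρ restricts to the graph x_0 = x, x_k = T_k(x) for k ≥ 1, since T_0 = H. On it the enlarged map
  -- has block 0 equal to x - H and all other blocks 0, which is what `hcomp` says with κ.
  set ρ : MvPolynomial (σ × Fin (d + 1)) ℂ →ₐ[ℂ] MvPolynomial σ ℂ :=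
    aeval fun p => (if p.2 = 0 then X p.1 - H p.1 else 0) + T p.1 p.2 with hρ
  set κ : MvPolynomial (σ × Fin (d + 1)) ℂ →ₐ[ℂ] MvPolynomial σ ℂ :=
    aeval fun p => if p.2 = 0 then X p.1 else 0 with hκ
  have hρr : ∀ g, ρ (rename (fun j => (j, 0)) g) = g := by
    intro g
    rw [hρ, aeval_rename]
    have : (fun p : σ × Fin (d + 1) => (if p.2 = 0 then X p.1 - H p.1 else 0) + T p.1 p.2) ∘
        (fun j => (j, 0)) = X := by
      funext j
      simp [hT0]
    rw [this, aeval_X_left_apply]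
  have hcomp : ρ.comp (aeval fun p => X p - companionMap K p) = F.comp κ := by
    refine algHom_ext fun p => ?_
    obtain ⟨j, k⟩ := p
    rw [AlgHom.comp_apply, AlgHom.comp_apply, aeval_X, map_sub, companionMap, map_add, hρr]
    have h2 : ρ (if h : (k : ℕ) + 1 < d + 1 then X (j, ⟨k + 1, h⟩) else 0) = T j (k + 1) := by
      split_ifs with h
      · rw [hρ, aeval_X]
        rw [if_neg fun h0 => absurd (congrArg Fin.val h0) (by simp), zero_add]
      · rw [map_zero, hTend _ _ (by omega)]
    rw [h2, hρ, aeval_X, hκ, aeval_X]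
    simp only
    rw [hTs]
    split_ifs with h
    · rw [hF, aeval_X]; ring
    · rw [map_zero]; ring
  intro g
  obtain ⟨P, hP⟩ := hsurj (rename (fun j => (j, 0)) g)
  refine ⟨κ P, ?_⟩
  have := congrArg (fun f => f P) hcomp
  simp only [AlgHom.comp_apply] at this
  rw [← this, hP, hρr]

end Reduction

/-! ### Normalisation of a Keller map and conclusion. -/

section JacobianConjecture

open MvPolynomial

/-- The kernels of the iterates stabilise. Writing x in the kernel as f^n(y) puts y in ker f^(n+1) =
ker f^n, so x = 0. -/
theorem RingHom.bijective_of_surjective_of_isNoetherianRing {R : Type*} [CommRing R]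
    [IsNoetherianRing R] (f : R →+* R) (hf : Function.Surjective f) : Function.Bijective f := by
  refine ⟨(injective_iff_map_eq_zero f).2 fun x hx => ?_, hf⟩
  let c : ℕ →o Ideal R := ⟨fun n => RingHom.ker (f ^ n), monotone_nat_of_le_succ fun n y hy => by
    rw [RingHom.mem_ker] at hy ⊢
    rw [pow_succ', RingHom.mul_def, RingHom.comp_apply, hy, map_zero]⟩
  obtain ⟨n, hn⟩ := monotone_stabilizes_iff_noetherian.2 inferInstance c
  obtain ⟨y, rfl⟩ : ∃ y, (f ^ n) y = x := by
    rw [RingHom.coe_pow]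
    exact hf.iterate n x
  have hy : y ∈ c (n + 1) := by
    show (f ^ (n + 1)) y = 0
    rw [pow_succ', RingHom.mul_def, RingHom.comp_apply, hx]
  rw [← hn (n + 1) n.le_succ] at hy
  exact hy

theorem eq_sum_homogeneousComponent_add_two {σ : Type*} {p : MvPolynomial σ ℂ} {d : ℕ}
    (hd : p.totalDegree ≤ d + 2) (h0 : constantCoeff p = 0)
    (h1 : ∀ j, constantCoeff (pderiv j p) = 0) :
    p = ∑ k : Fin (d + 1), homogeneousComponent (k + 2) p := by
  have hc0 : homogeneousComponent 0 p = 0 := by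
    rw [homogeneousComponent_zero, ← constantCoeff_eq, h0, map_zero]
  have hc1 : homogeneousComponent 1 p = 0 := by
    apply homogeneousComponent_eq_zero'
    intro s hs hdeg
    obtain ⟨j, rfl⟩ := (Finsupp.sum_eq_one_iff s).1 hdeg
    have := h1 j
    rw [constantCoeff_eq, coeff_pderiv] at this
    simp at this
    exact mem_support_iff.1 hs this
  have h2 : ∑ k ∈ Finset.range (d + 3), homogeneousComponent k p = p := by
    conv_rhs => rw [← sum_homogeneousComponent p]
    refine (Finset.sum_subset (Finset.range_mono (by omega)) fun k _ hk => ?_).symm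
    exact homogeneousComponent_eq_zero _ _ (by simpa using hk)
  rw [Finset.sum_range_succ', Finset.sum_range_succ', hc0, zero_add, hc1, add_zero, add_zero,
    Finset.sum_range] at h2
  exact h2.symm

theorem bijective_of_det_jacobianMatrix_eq_one {n : ℕ}
    (hn : ∀ d : ℕ, HasImageProperty (Fin n × Fin (d + 1)))
    (φ : MvPolynomial (Fin n) ℂ →ₐ[ℂ] MvPolynomial (Fin n) ℂ)
    (hφ : (jacobianMatrix φ).det = 1) : Function.Bijective φ := by
  refine RingHom.bijective_of_surjective_of_isNoetherianRing φ.toRingHom ?_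
  set A : Matrix (Fin n) (Fin n) ℂ := (constantCoeff).mapMatrix (jacobianMatrix φ) with hA
  have hAdet : A.det = 1 := by
    rw [hA, ← RingHom.map_det, hφ, map_one]
  have hAinv : A⁻¹ * A = 1 := Matrix.nonsing_inv_mul _ (by rw [hAdet]; exact isUnit_one)
  -- α subtracts the constant terms of φ and inverts its linear part, so that φ ∘ α is the identity
  -- minus terms of degree at least 2.
  set α : MvPolynomial (Fin n) ℂ →ₐ[ℂ] MvPolynomial (Fin n) ℂ :=
    aeval fun i => ∑ j, C (A⁻¹ i j) * (X j - C (constantCoeff (φ (X j)))) with hα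
  have hφC : ∀ a : ℂ, φ (C a) = C a := fun a => φ.commutes a
  have hαX : ∀ i, φ (α (X i)) = ∑ j, C (A⁻¹ i j) * (φ (X j) - C (constantCoeff (φ (X j)))) := by
    intro i
    simp [hα, hφC]
  set H : Fin n → MvPolynomial (Fin n) ℂ := fun i => X i - φ (α (X i)) with hH
  have hJ : 1 - polyJacobian H = (C (σ := Fin n)).mapMatrix A⁻¹ * jacobianMatrix φ := by
    ext1 i j
    rw [Matrix.sub_apply, Matrix.mul_apply]
    simp only [polyJacobian, Matrix.of_apply, hH, map_sub, hαX, map_sum, pderiv_C_mul, pderiv_C,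
      sub_zero, pderiv_X, jacobianMatrix, RingHom.mapMatrix_apply, Matrix.map_apply]
    simp [Matrix.one_apply, Pi.single_apply]
  have hdet : (1 - polyJacobian H).det = 1 := by
    rw [hJ, Matrix.det_mul, hφ, mul_one, ← RingHom.map_det, Matrix.det_nonsing_inv, hAdet]
    simp
  have hH0 : ∀ i, constantCoeff (H i) = 0 := by
    intro i
    simp [hH, hαX]
  have hH1 : ∀ i j, constantCoeff (pderiv j (H i)) = 0 := by
    intro i j
    have h1 := congrArg (fun M => constantCoeff (M i j)) hJ
    have h2 : constantCoeff.mapMatrix ((C (σ := Fin n)).mapMatrix A⁻¹ * jacobianMatrix φ) = 1 := by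
      rw [map_mul, ← hA, ← hAinv]
      congr 1
      ext i j
      simp
    have h3 := congrFun (congrFun h2 i) j
    rw [RingHom.mapMatrix_apply, Matrix.map_apply] at h3
    simp only [h3, Matrix.sub_apply, map_sub] at h1
    have h4 : constantCoeff ((1 : Matrix (Fin n) (Fin n) (MvPolynomial (Fin n) ℂ)) i j) =
        (1 : Matrix (Fin n) (Fin n) ℂ) i j := by
      simp only [Matrix.one_apply]
      split_ifs <;> simp
    rw [h4] at h1
    simpa [polyJacobian] using h1
  set d := Finset.univ.sup fun i => (H i).totalDegree
  have hd : ∀ i, (H i).totalDegree ≤ d + 2 := fun i =>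
    (Finset.le_sup (f := fun i => (H i).totalDegree) (Finset.mem_univ i)).trans (by omega)
  have hsurj := surjective_of_det_one_sub_polyJacobian hn
    (K := fun i (k : Fin (d + 1)) => homogeneousComponent (k + 2) (H i))
    (fun i k => homogeneousComponent_isHomogeneous _ _)
    (fun i => eq_sum_homogeneousComponent_add_two (hd i) (hH0 i) (hH1 i)) hdet
  have hcomp : (aeval (R := ℂ) fun i => X i - H i) = φ.comp α := by
    refine algHom_ext fun i => ?_
    simp only [aeval_X, hH, sub_sub_cancel, AlgHom.comp_apply]
  intro g
  obtain ⟨p, hp⟩ := hsurj g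
  exact ⟨α p, by rw [← hp, hcomp]; rfl⟩

end JacobianConjecture

theorem mainTheorem4
    (h : ∀ n : ℕ, 0 < n →
      MZVertex.IsMZSubspace (Heisenberg.Y (Fin n ⊕ Fin n)) (Heisenberg.imageSubspace n)) :
    ∀ n : ℕ, 0 < n →
      ∀ φ : MvPolynomial (Fin n) ℂ →ₐ[ℂ] MvPolynomial (Fin n) ℂ,
        (jacobianMatrix φ).det = 1 → Function.Bijective φ := by
  intro n hn φ hφ
  refine bijective_of_det_jacobianMatrix_eq_one (fun d => ?_) φ hφ
  -- The number d + 1 of blocks depends on the degree of φ, so the hypothesis is needed in the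
  -- dimensions n(d + 1) for every d.
  exact HasImageProperty.of_equiv finProdFinEquiv
    (Heisenberg.hasImageProperty_of_isMZSubspace (h _ (Nat.mul_pos hn d.succ_pos)))
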